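/- Let $P_{XY}$ be a pmf on a finite alphabet $\mathcal X\times\mathcal Y$, with entropies $H(P_X),H(P_Y),H(P_{XY})$, conditional entropies $H(P_{X|Y}|P_Y),H(P_{Y|X}|P_X)$ (natural logarithms), and with positive varentropies $$\mathrm V(P_{XY})=\sum_{x,y}P_{XY}(x,y)\big(-\log P_{XY}(x,y)-H(P_{XY})\big)^2,$$ $$\mathrm V(P_{X|Y}|P_Y)=\sum_{x,y}P_{XY}(x,y)\big(-\log P_{X|Y}(x|y)-H(P_{X|Y}|P_Y)\big)^2,$$ and $\mathrm V(P_{Y|X}|P_X)$ (defined by exchanging the roles of $X$ and $Y$). Let $T_1,T_2\ge 1$ be integers, and let $(\xi_n)$ be a positive sequence with $\xi_n\to0$ and $\frac{\log n}{n\xi_n^2}\to0$. The source emits i.i.d. pairs with law $P_{XY}$, grouped in blocks $(\mathbf X_k,\mathbf Y_k)\in\mathcal X^n\times\mathcal Y^n$, $k\ge1$. An $(n,N_1,N_2,T_1,T_2,\varepsilon)$-code consists of encoders $f_k:\mathcal X^{kn}\to\mathcal M_1$ and $g_k:\mathcal Y^{kn}\to\mathcal M_2$, $k\ge 1$, with $|\mathcal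 M_i|=N_i$, producing at time $k$ the codewords $M_{1,k}=f_k(\mathbf X_1,\dots,\mathbf X_k)$ and $M_{2,k}=g_k(\mathbf Y_1,\dots,\mathbf Y_k)$, and of decoders which, for every integer $k$ with $\max\{k_1,k_2\}\ge1$, where $k_1=k$ and $k_2=k+T_1-T_2$, map the first $k+T_1-1$ codewords of both encoders to an estimate $(\hat{\mathbf X}_{k_1},\hat{\mathbf Y}_{k_2})$ such that $\Pr\big((\hat{\mathbf X}_{k_1},\hat{\mathbf Y}_{k_2})\ne(\mathbf X_{k_1},\mathbf Y_{k_2})\big)\le\varepsilon$; here a block with a non-positive index is disregarded. So $\mathbf X$ is decoded with a delay of $T_1$ blocks and $\mathbf Y$ with a delay of $T_2$ blocks. The encoders and the decoder share common randomness independent of the source, so all these maps may also depend on a common random seed, over which the probability is averaged too. For $R_X^*,R_Y^*\in\mathbb R$ and $\boldsymbol\theta=(\theta_1,\theta_2)\in\mathbb R^2$, a number $\nu$ is achievable if there is a sequence of $(n,N_1,N_2,T_1,T_2,\varepsilon_n)$-codes (with $N_1,N_2$ depending on $n$) such that $$\limsup_{n\to\infty}\frac{\log N_1-nR_X^*}{n\xi_n}\le\theta_1,\qquad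 \limsup_{n\to\infty}\frac{\log N_2-nR_Y^*}{n\xi_n}\le\theta_2,\qquad \liminf_{n\to\infty}-\frac{\log\varepsilon_n}{n\xi_n^2}\ge\nu.$$ Let $\nu^*=\nu^*(R_X^*,R_Y^*,\boldsymbol\theta,T_1,T_2)\in[-\infty,\infty]$ be the supremum of all achievable $\nu$, and let $T=\min\{T_1,T_2\}$. Then: (i) If $R_X^*=H(P_{X|Y}|P_Y)$, $R_Y^*>H(P_Y)$ and $\theta_1>0$, then $$\nu^*\ge\frac{T\theta_1^2}{2\mathrm V(P_{X|Y}|P_Y)}.$$ (ii) If $R_X^*=H(P_{X|Y}|P_Y)$, $R_Y^*=H(P_Y)$, $H(P_{Y|X}|P_X)<H(P_Y)$ (that is, $X$ and $Y$ are not independent), $\theta_1>0$ and $\theta_2>-\theta_1$, then $$\nu^*\ge T\min\left\{\inf_{\gamma\in[0,1]}\frac{(\theta_1+(1-\gamma)\theta_2)^2}{2\left(\gamma\mathrm V(P_{X|Y}|P_Y)+(1-\gamma)\mathrm V(P_{XY})\right)},\ \frac{(\theta_1+\theta_2)^2}{2\mathrm V(P_{XY})}\right\}.$$ (iii) If $R_X^*+R_Y^*=H(P_{XY})$,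 $H(P_{X|Y}|P_Y)<R_X^*<H(P_X)$, $H(P_{Y|X}|P_X)<R_Y^*<H(P_Y)$ and $\theta_2>-\theta_1$, then $$\nu^*\ge\frac{T(\theta_1+\theta_2)^2}{2\mathrm V(P_{XY})}.$$ -/

import Mathlib

open Filter Topology MeasureTheory

noncomputable section

namespace StreamingSW

/-! ### Information quantities of a joint pmf (natural logarithms, finite alphabets) -/

section Info

variable {α β : Type*} [Fintype α] [Fintype β]

/-- Entropy `H(P)` of a pmf `P` on a finite set. -/
def entropy (P : α → ℝ) : ℝ := ∑ a, P a * (-Real.log (P a))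

/-- First marginal `P_X` of `P_{XY}`. -/
def fstMarginal (P : α × β → ℝ) (a : α) : ℝ := ∑ b, P (a, b)

/-- Second marginal `P_Y` of `P_{XY}`. -/
def sndMarginal (P : α × β → ℝ) (b : β) : ℝ := ∑ a, P (a, b)

/-- The joint pmf with the two components interchanged, `P_{YX}`. -/
def swapPmf (P : α × β → ℝ) : β × α → ℝ := fun z => P z.swap

/-- The conditional pmf `P_{X|Y}(a | b)`. -/
def condPmf (P : α × β → ℝ) (a : α) (b : β) : ℝ := P (a, b) / sndMarginal P b

/-- Conditional entropy `H(P_{X|Y} | P_Y)` (first component given the second). -/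
def condEntropy (P : α × β → ℝ) : ℝ := ∑ z : α × β, P z * (-Real.log (condPmf P z.1 z.2))

/-- Varentropy (source dispersion) `V(P)`. -/
def varentropy (P : α → ℝ) : ℝ := ∑ a, P a * (-Real.log (P a) - entropy P) ^ 2

/-- Conditional varentropy `V(P_{X|Y} | P_Y)` (first component given the second). -/
def condVarentropy (P : α × β → ℝ) : ℝ :=
  ∑ z : α × β, P z * (-Real.log (condPmf P z.1 z.2) - condEntropy P) ^ 2

end Info

/-! ### Streaming Slepian-Wolf codes -/

/-- The encoders and decoders of a streaming Slepian-Wolf code with blocklength `n` and codeword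
alphabets of sizes `N₁`, `N₂`. Both encoders and the decoder share common randomness: a seed drawn
from a probability space, independently of the sources. At time `k` the encoders see the
first `k` source blocks and emit one codeword each; at time `τ` the decoder sees the first `τ`
codeword pairs and outputs an estimate of one `𝒳`-block and one `𝒴`-block.
(`x i` with `i : Fin k` is the block number `i + 1`, and likewise for codewords.) -/
structure Code (𝒳 𝒴 : Type*) (n N₁ N₂ : ℕ) where
  /-- The space of values of the common randomness. -/
  Seed : Type
  /-- Its σ-algebra. -/
  seedSpace : MeasurableSpace Seed
  /-- The law of the common randomness. -/
  seedLaw : @Measure Seed seedSpace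
  isProb : @IsProbabilityMeasure Seed seedSpace seedLaw
  /-- The encoding functions `f_k`. -/
  encX : (k : ℕ) → Seed → (Fin k → Fin n → 𝒳) → Fin N₁
  /-- The encoding functions `g_k`. -/
  encY : (k : ℕ) → Seed → (Fin k → Fin n → 𝒴) → Fin N₂
  /-- The decoding function used at time `τ`. -/
  dec : (τ : ℕ) → Seed → (Fin τ → Fin N₁) → (Fin τ → Fin N₂) → (Fin n → 𝒳) × (Fin n → 𝒴)
  measurable_encX : ∀ k x c, @MeasurableSet Seed seedSpace {w | encX k w x = c}
  measurable_encY : ∀ k y c, @MeasurableSet Seed seedSpace {w | encY k w y = c}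
  measurable_dec : ∀ τ m₁ m₂ z, @MeasurableSet Seed seedSpace {w | dec τ w m₁ m₂ = z}

namespace Code

variable {𝒳 𝒴 : Type*} {n N₁ N₂ : ℕ}

/-- The decoder's output at time `τ` when the seed is `w` and the first `τ` pairs of source blocks
are `s`: the codewords number `j + 1`, `j : Fin τ`, are computed from the first `j + 1` blocks. -/
def output (C : Code 𝒳 𝒴 n N₁ N₂) (τ : ℕ) (s : Fin τ → Fin n → 𝒳 × 𝒴) (w : C.Seed) :
    (Fin n → 𝒳) × (Fin n → 𝒴) :=
  C.dec τ w
    (fun j => C.encX (j + 1) w (fun i l => (s (Fin.castLE j.isLt i) l).1))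
    (fun j => C.encY (j + 1) w (fun i l => (s (Fin.castLE j.isLt i) l).2))

/-- The set of seeds for which the decoder errs at time `τ`, when the first `τ` pairs of source
blocks are `s`. With delays `T₁`, `T₂`, the output at time `τ` is an estimate of the `𝒳`-block
number `k₁ = τ - T₁ + 1` and of the `𝒴`-block number `k₂ = τ - T₂ + 1`; a block whose number is not
positive is disregarded. (The block number `k₁` is `s i` for the `i : Fin τ` with `i + T₁ = τ`.) -/
def errorSet (C : Code 𝒳 𝒴 n N₁ N₂) (T₁ T₂ τ : ℕ) (s : Fin τ → Fin n → 𝒳 × 𝒴) : Set C.Seed :=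
  {w | (∃ i : Fin τ, (i : ℕ) + T₁ = τ ∧ (C.output τ s w).1 ≠ fun l => (s i l).1) ∨
       (∃ i : Fin τ, (i : ℕ) + T₂ = τ ∧ (C.output τ s w).2 ≠ fun l => (s i l).2)}

/-- The error probability at time `τ`: the first `τ` pairs of source blocks consist of `τ * n`
symbol pairs drawn i.i.d. from `P`, and the seed is independent of them. -/
def errorProb [Fintype 𝒳] [Fintype 𝒴] (C : Code 𝒳 𝒴 n N₁ N₂) (P : 𝒳 × 𝒴 → ℝ) (T₁ T₂ τ : ℕ) : ℝ :=
  ∑ s : Fin τ → Fin n → 𝒳 × 𝒴,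
    (∏ i, ∏ l, P (s i l)) * (@Measure.real C.Seed C.seedSpace C.seedLaw (C.errorSet T₁ T₂ τ s))

end Code

section MDC

variable {𝒳 𝒴 : Type*} [Fintype 𝒳] [Fintype 𝒴]

/-- There is an `(n, N₁, N₂, T₁, T₂, ε)`-code for the source `P`. Every decoding time `τ` is
considered, i.e. every `k = τ - T₁ + 1`; at times `τ < min T₁ T₂` nothing has to be decoded. -/
def ExistsCode (P : 𝒳 × 𝒴 → ℝ) (n N₁ N₂ T₁ T₂ : ℕ) (ε : ℝ) : Prop :=
  ∃ C : Code 𝒳 𝒴 n N₁ N₂, ∀ τ : ℕ, C.errorProb P T₁ T₂ τ ≤ ε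

/-- `ν` is an `(RX, RY, (θ₁, θ₂), T₁, T₂)`-achievable moderate deviations constant with respect to
the sequence `ξ`. Taking the bounds `ε n` on the error probabilities positive is no restriction;
upper and lower limits are taken in the extended reals. -/
def Achievable (P : 𝒳 × 𝒴 → ℝ) (ξ : ℕ → ℝ) (RX RY θ₁ θ₂ : ℝ) (T₁ T₂ : ℕ) (ν : ℝ) : Prop :=
  ∃ (N₁ N₂ : ℕ → ℕ) (ε : ℕ → ℝ),
    (∀ n, 0 < ε n) ∧
    (∀ n, ExistsCode P n (N₁ n) (N₂ n) T₁ T₂ (ε n)) ∧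
    limsup (fun n : ℕ => (((Real.log (N₁ n) - n * RX) / (n * ξ n) : ℝ) : EReal)) atTop
      ≤ (θ₁ : EReal) ∧
    limsup (fun n : ℕ => (((Real.log (N₂ n) - n * RY) / (n * ξ n) : ℝ) : EReal)) atTop
      ≤ (θ₂ : EReal) ∧
    (ν : EReal) ≤
      liminf (fun n : ℕ => ((-(Real.log (ε n) / (n * ξ n ^ 2)) : ℝ) : EReal)) atTop

/-- The moderate deviations constant `ν*(RX, RY, θ, T₁, T₂)`: the supremum, in the extended reals,
of all achievable moderate deviations constants. -/
def nuStar (P : 𝒳 × 𝒴 → ℝ) (ξ : ℕ → ℝ) (RX RY θ₁ θ₂ : ℝ) (T₁ T₂ : ℕ) : EReal :=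
  sSup {v : EReal | ∃ ν : ℝ, Achievable P ξ RX RY θ₁ θ₂ T₁ T₂ ν ∧ v = (ν : EReal)}

end MDC

end StreamingSW

end

/-! Each encoder puts every prefix of its stream into an independent uniform bin, and the decoder
takes a most likely pair of streams consistent with all codewords received so far. Suppose a
competitor first differs from the truth in the blocks `j.1` and `j.2` of the two streams. From these
blocks on, truth and competitor are binned independently, so the competitor survives with
probability at most N₁^-(τ-j.1) * N₂^-(τ-j.2) (`collision_le`). The number of competitors at least
as likely as the truth is at most the exponential of a sum of information densities: of X given Y,
of Y given X, or of the pair, according to what is wrong in each block (`ncard_competitors_mul_le`).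
Since min(1, e^u) ≤ e^(σu) for σ in [0,1], each error pattern contributes at most a product of
moment generating functions (`errorProb_binningCode_le`).

Near the origin these functions are sub-Gaussian, with a variance factor as close to the variance as
desired (`exists_infoMgf_le`). Taking σ of order ξ_n yields an exponent n ξ_n² E per wrong block
(`ExponentBound`). A block type whose rate strictly exceeds its entropy is harmless; at equality one
optimises a quadratic in σ. At the corner point of case (ii) the X-only and the joint errors are
both critical, and the fraction γ of X-only blocks produces the infimum.

An error at the prescribed delays involves at least T = min(T₁, T₂) wrong blocks, and the sum over
all patterns is dominated by a geometric one, so the bound is uniform in the decoding time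
(`sum_errorPositions_le`). -/

namespace StreamingSW

/-! ### Information densities -/

section InfoDensity

variable {𝒳 𝒴 : Type*} [Fintype 𝒳] [Fintype 𝒴]

/-- `z'` agrees with `z` in each coordinate that is not marked as free by `c`. -/
def Agrees (c : Bool × Bool) (z z' : 𝒳 × 𝒴) : Prop :=
  (c.1 = false → z'.1 = z.1) ∧ (c.2 = false → z'.2 = z.2)

open scoped Classical in
/-- The symbol pairs that agree with `z` outside the free coordinates. -/
noncomputable def slice (c : Bool × Bool) (z : 𝒳 × 𝒴) : Finset (𝒳 × 𝒴) :=
  Finset.univ.filter (Agrees c z)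

lemma mem_slice {c : Bool × Bool} {z z' : 𝒳 × 𝒴} :
    z' ∈ slice c z ↔ (c.1 = false → z'.1 = z.1) ∧ (c.2 = false → z'.2 = z.2) := by
  simp [slice, Agrees]

/-- The mass of a slice. -/
noncomputable def sliceMass (P : 𝒳 × 𝒴 → ℝ) (c : Bool × Bool) (z : 𝒳 × 𝒴) : ℝ :=
  ∑ z' ∈ slice c z, P z'

/-- The (conditional) self-information of the free coordinates given the other ones. -/
noncomputable def infoDensity (P : 𝒳 × 𝒴 → ℝ) (c : Bool × Bool) (z : 𝒳 × 𝒴) : ℝ :=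
  Real.log (sliceMass P c z / P z)

/-- The mean of the information density. -/
noncomputable def infoMean (P : 𝒳 × 𝒴 → ℝ) (c : Bool × Bool) : ℝ :=
  ∑ z, P z * infoDensity P c z

/-- The variance of the information density. -/
noncomputable def infoVar (P : 𝒳 × 𝒴 → ℝ) (c : Bool × Bool) : ℝ :=
  ∑ z, P z * (infoDensity P c z - infoMean P c) ^ 2

/-- The moment generating function of the information density. -/
noncomputable def infoMgf (P : 𝒳 × 𝒴 → ℝ) (c : Bool × Bool) (s : ℝ) : ℝ :=
  ∑ z, P z * Real.exp (s * infoDensity P c z)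

lemma self_mem_slice (c : Bool × Bool) (z : 𝒳 × 𝒴) : z ∈ slice c z := by simp [mem_slice]

lemma le_sliceMass {P : 𝒳 × 𝒴 → ℝ} (h0 : ∀ z, 0 ≤ P z) (c : Bool × Bool) (z : 𝒳 × 𝒴) :
    P z ≤ sliceMass P c z :=
  Finset.single_le_sum (f := P) (fun z _ => h0 z) (self_mem_slice c z)

lemma sliceMass_fixed (P : 𝒳 × 𝒴 → ℝ) (z : 𝒳 × 𝒴) : sliceMass P (false, false) z = P z := by
  have : slice (false, false) z = {z} := by
    ext z'
    simp [mem_slice, Prod.ext_iff]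
  simp [sliceMass, this]

lemma sliceMass_both {P : 𝒳 × 𝒴 → ℝ} (h1 : ∑ z, P z = 1) (z : 𝒳 × 𝒴) :
    sliceMass P (true, true) z = 1 := by
  have : slice (true, true) z = Finset.univ := by
    ext z'
    simp [mem_slice]
  simp [sliceMass, this, h1]

lemma sliceMass_fst (P : 𝒳 × 𝒴 → ℝ) (z : 𝒳 × 𝒴) :
    sliceMass P (true, false) z = sndMarginal P z.2 := by
  classical
  rw [sliceMass, sndMarginal]
  refine (Finset.sum_bij (fun a _ => (a, z.2)) ?_ ?_ ?_ fun _ _ => rfl).symm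
  · simp [mem_slice]
  · simp
  · rintro ⟨a, b⟩ h
    simpa [mem_slice, eq_comm] using h

lemma sliceMass_snd (P : 𝒳 × 𝒴 → ℝ) (z : 𝒳 × 𝒴) :
    sliceMass P (false, true) z = fstMarginal P z.1 := by
  classical
  rw [sliceMass, fstMarginal]
  refine (Finset.sum_bij (fun b _ => (z.1, b)) ?_ ?_ ?_ fun _ _ => rfl).symm
  · simp [mem_slice]
  · simp
  · rintro ⟨a, b⟩ h
    simpa [mem_slice, eq_comm] using h

lemma infoDensity_both {P : 𝒳 × 𝒴 → ℝ} (h1 : ∑ z, P z = 1) (z : 𝒳 × 𝒴) :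
    infoDensity P (true, true) z = -Real.log (P z) := by
  rw [infoDensity, sliceMass_both h1, one_div, Real.log_inv]

lemma infoDensity_fst (P : 𝒳 × 𝒴 → ℝ) (z : 𝒳 × 𝒴) :
    infoDensity P (true, false) z = -Real.log (condPmf P z.1 z.2) := by
  rw [infoDensity, sliceMass_fst, condPmf, ← Real.log_inv, inv_div]

lemma infoDensity_snd (P : 𝒳 × 𝒴 → ℝ) (z : 𝒳 × 𝒴) :
    infoDensity P (false, true) z = -Real.log (condPmf (swapPmf P) z.2 z.1) := by
  rw [infoDensity, sliceMass_snd, condPmf, ← Real.log_inv, inv_div]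
  rfl

lemma infoMean_both {P : 𝒳 × 𝒴 → ℝ} (h1 : ∑ z, P z = 1) :
    infoMean P (true, true) = entropy P := by
  simp only [infoMean, infoDensity_both h1, entropy]

lemma infoMean_fst (P : 𝒳 × 𝒴 → ℝ) : infoMean P (true, false) = condEntropy P := by
  simp only [infoMean, infoDensity_fst, condEntropy]

lemma infoMean_snd (P : 𝒳 × 𝒴 → ℝ) : infoMean P (false, true) = condEntropy (swapPmf P) := by
  simp only [infoMean, infoDensity_snd, condEntropy]
  rw [← Equiv.sum_comp (Equiv.prodComm 𝒴 𝒳)]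
  rfl

lemma infoVar_both {P : 𝒳 × 𝒴 → ℝ} (h1 : ∑ z, P z = 1) :
    infoVar P (true, true) = varentropy P := by
  simp only [infoVar, infoDensity_both h1, varentropy, infoMean_both h1]

lemma infoVar_fst (P : 𝒳 × 𝒴 → ℝ) : infoVar P (true, false) = condVarentropy P := by
  simp only [infoVar, infoDensity_fst, condVarentropy, infoMean_fst]

lemma infoVar_snd (P : 𝒳 × 𝒴 → ℝ) : infoVar P (false, true) = condVarentropy (swapPmf P) := by
  simp only [infoVar, infoDensity_snd, condVarentropy, infoMean_snd]
  rw [← Equiv.sum_comp (Equiv.prodComm 𝒴 𝒳)]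
  rfl

/-- Correct blocks cost nothing: their information density vanishes. -/
lemma infoMgf_fixed {P : 𝒳 × 𝒴 → ℝ} (h1 : ∑ z, P z = 1) (s : ℝ) :
    infoMgf P (false, false) s = 1 := by
  rw [← h1, infoMgf]
  refine Finset.sum_congr rfl fun z _ => ?_
  rw [infoDensity, sliceMass_fixed]
  rcases eq_or_ne (P z) 0 with h | h
  · simp [h]
  · simp [div_self h]

lemma infoMgf_nonneg {P : 𝒳 × 𝒴 → ℝ} (h0 : ∀ z, 0 ≤ P z) (c : Bool × Bool) (s : ℝ) :
    0 ≤ infoMgf P c s :=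
  Finset.sum_nonneg fun z _ => mul_nonneg (h0 z) (Real.exp_nonneg _)

lemma infoMean_nonneg {P : 𝒳 × 𝒴 → ℝ} (h0 : ∀ z, 0 ≤ P z) (c : Bool × Bool) :
    0 ≤ infoMean P c := by
  refine Finset.sum_nonneg fun z _ => ?_
  rcases (h0 z).eq_or_lt with h | h
  · simp [← h]
  · refine mul_nonneg h.le (Real.log_nonneg ?_)
    rw [one_le_div h]
    exact le_sliceMass h0 c z

lemma sum_mul_log_sndMarginal (P : 𝒳 × 𝒴 → ℝ) :
    ∑ z, P z * (-Real.log (sndMarginal P z.2)) = entropy (sndMarginal P) := by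
  rw [Fintype.sum_prod_type_right, entropy]
  refine Finset.sum_congr rfl fun b _ => ?_
  change ∑ a, P (a, b) * -Real.log (sndMarginal P b) = _
  rw [← Finset.sum_mul]
  rfl

lemma le_sndMarginal {P : 𝒳 × 𝒴 → ℝ} (h0 : ∀ z, 0 ≤ P z) (z : 𝒳 × 𝒴) :
    P z ≤ sndMarginal P z.2 := sliceMass_fst P z ▸ le_sliceMass h0 _ z

lemma le_fstMarginal {P : 𝒳 × 𝒴 → ℝ} (h0 : ∀ z, 0 ≤ P z) (z : 𝒳 × 𝒴) :
    P z ≤ fstMarginal P z.1 := sliceMass_snd P z ▸ le_sliceMass h0 _ z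

/-- The chain rule `H(P_{XY}) = H(P_{X|Y} | P_Y) + H(P_Y)`. -/
lemma entropy_eq_condEntropy_add {P : 𝒳 × 𝒴 → ℝ} (h0 : ∀ z, 0 ≤ P z) :
    entropy P = condEntropy P + entropy (sndMarginal P) := by
  rw [← sum_mul_log_sndMarginal, condEntropy, entropy, ← Finset.sum_add_distrib]
  refine Finset.sum_congr rfl fun z _ => ?_
  rcases (h0 z).eq_or_lt with h | h
  · simp [← h]
  · have h2 := h.trans_le (le_sndMarginal h0 z)
    have : condPmf P z.1 z.2 = P z / sndMarginal P z.2 := rfl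
    rw [this, Real.log_div h.ne' h2.ne']
    ring

/-- Conditioning reduces entropy. -/
lemma condEntropy_swap_le {P : 𝒳 × 𝒴 → ℝ} (h0 : ∀ z, 0 ≤ P z) (h1 : ∑ z, P z = 1) :
    condEntropy (swapPmf P) ≤ entropy (sndMarginal P) := by
  have key : ∀ z, P z * infoDensity P (false, true) z - P z * (-Real.log (sndMarginal P z.2))
      ≤ fstMarginal P z.1 * sndMarginal P z.2 - P z := by
    intro z
    rcases (h0 z).eq_or_lt with h | h
    · rw [← h]
      have : 0 ≤ fstMarginal P z.1 * sndMarginal P z.2 :=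
        mul_nonneg (Finset.sum_nonneg fun b _ => h0 _) (Finset.sum_nonneg fun b _ => h0 _)
      simpa using this
    · have h2 := h.trans_le (le_sndMarginal h0 z)
      have h3 := h.trans_le (le_fstMarginal h0 z)
      -- This is log t ≤ t - 1 at t = P_X P_Y / P_XY; the right-hand sides, weighted by P, sum to at
      -- most zero.
      have h4 := Real.log_le_sub_one_of_pos (x := fstMarginal P z.1 / P z * sndMarginal P z.2)
        (by positivity)
      rw [Real.log_mul (by positivity) h2.ne'] at h4
      rw [infoDensity, sliceMass_snd]
      have h5 := mul_le_mul_of_nonneg_left h4 h.le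
      have h6 : P z * (fstMarginal P z.1 / P z * sndMarginal P z.2 - 1)
          = fstMarginal P z.1 * sndMarginal P z.2 - P z := by
        field_simp
      linarith
  have hsum := Finset.sum_le_sum fun z (_ : z ∈ Finset.univ) => key z
  rw [Finset.sum_sub_distrib, Finset.sum_sub_distrib, sum_mul_log_sndMarginal, h1] at hsum
  have h7 : ∑ z : 𝒳 × 𝒴, fstMarginal P z.1 * sndMarginal P z.2 = 1 := by
    rw [Fintype.sum_prod_type, ← Finset.sum_mul_sum]
    have e1 : ∑ a, fstMarginal P a = 1 := by
      rw [← h1, Fintype.sum_prod_type]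
      rfl
    have e2 : ∑ b, sndMarginal P b = 1 := by
      rw [← h1, Fintype.sum_prod_type_right]
      rfl
    rw [e1, e2, one_mul]
  have h8 : ∑ z, P z * infoDensity P (false, true) z = condEntropy (swapPmf P) := infoMean_snd P
  linarith

/-- A sub-Gaussian bound near the origin, with a variance factor close to the variance. -/
lemma exists_sum_mul_exp_le {ι : Type*} [Fintype ι] (p L : ι → ℝ) (h0 : ∀ z, 0 ≤ p z)
    (h1 : ∑ z, p z = 1) (H V V' : ℝ) (hH : ∑ z, p z * L z = H)
    (hV : ∑ z, p z * (L z - H) ^ 2 = V) (hV' : V < V') :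
    ∃ s₀ > 0, ∀ s, 0 ≤ s → s ≤ s₀ →
      ∑ z, p z * Real.exp (s * L z) ≤ Real.exp (s * H + s ^ 2 * V' / 2) := by
  set M : ℝ := 1 + ∑ z, |L z - H| with hM
  have hM1 : 1 ≤ M := le_add_of_nonneg_right (Finset.sum_nonneg fun z _ => abs_nonneg _)
  have hLM : ∀ z, |L z - H| ≤ M := fun z =>
    (Finset.single_le_sum (f := fun z => |L z - H|) (fun z _ => abs_nonneg _)
      (Finset.mem_univ z)).trans (by linarith)
  have hM0 : 0 < M := by linarith
  -- The first bound keeps the exponent in [-1, 1], where the Taylor estimate applies; the second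
  -- lets the gap V' - V absorb the cubic remainder.
  refine ⟨min (1 / M) ((V' - V) / M ^ 3), lt_min (by positivity)
    (div_pos (by linarith) (by positivity)), fun s hs hs0 => ?_⟩
  have hsM : s * M ≤ 1 := by
    have := hs0.trans (min_le_left _ _)
    rwa [le_div_iff₀ hM0] at this
  have hsV : s * M ^ 3 ≤ V' - V := by
    have := hs0.trans (min_le_right _ _)
    rwa [le_div_iff₀ (by positivity)] at this
  have hz : ∀ z, Real.exp (s * (L z - H)) ≤
      1 + s * (L z - H) + s ^ 2 * (L z - H) ^ 2 / 2 + s ^ 3 * M ^ 3 / 2 := by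
    intro z
    have hab : |s * (L z - H)| ≤ s * M := by
      rw [abs_mul, abs_of_nonneg hs]
      exact mul_le_mul_of_nonneg_left (hLM z) hs
    have hb := Real.exp_bound (x := s * (L z - H)) (hab.trans hsM) (n := 3) (by norm_num)
    have h3 : |s * (L z - H)| ^ 3 ≤ (s * M) ^ 3 := pow_le_pow_left₀ (abs_nonneg _) hab 3
    have hb2 := (abs_le.mp hb).2
    simp only [Finset.sum_range_succ, Finset.sum_range_zero, Nat.factorial] at hb2
    norm_num [-abs_mul] at hb2
    have h4 : 0 ≤ (s * M) ^ 3 := by positivity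
    rw [mul_pow s M] at h3 h4
    rw [mul_pow s (L z - H)] at hb2
    linarith
  have hsum : ∑ z, p z * Real.exp (s * (L z - H)) ≤ 1 + s ^ 2 * V / 2 + s ^ 3 * M ^ 3 / 2 := by
    calc ∑ z, p z * Real.exp (s * (L z - H))
        ≤ ∑ z, p z * (1 + s * (L z - H) + s ^ 2 * (L z - H) ^ 2 / 2 + s ^ 3 * M ^ 3 / 2) :=
          Finset.sum_le_sum fun z _ => mul_le_mul_of_nonneg_left (hz z) (h0 z)
      _ = ∑ z, (p z * (1 + s ^ 3 * M ^ 3 / 2 - s * H) + (p z * L z) * s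
            + (p z * (L z - H) ^ 2) * (s ^ 2 / 2)) :=
          Finset.sum_congr rfl fun z _ => by ring
      _ = 1 + s ^ 2 * V / 2 + s ^ 3 * M ^ 3 / 2 := by
          rw [Finset.sum_add_distrib, Finset.sum_add_distrib, ← Finset.sum_mul, ← Finset.sum_mul,
            ← Finset.sum_mul, h1, hH, hV]
          ring
  have hexp : 1 + s ^ 2 * V / 2 + s ^ 3 * M ^ 3 / 2 ≤ Real.exp (s ^ 2 * V' / 2) := by
    have := Real.add_one_le_exp (s ^ 2 * V' / 2)
    have h5 : s ^ 2 * (s * M ^ 3) ≤ s ^ 2 * (V' - V) :=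
      mul_le_mul_of_nonneg_left hsV (sq_nonneg s)
    nlinarith
  calc ∑ z, p z * Real.exp (s * L z)
      = Real.exp (s * H) * ∑ z, p z * Real.exp (s * (L z - H)) := by
        rw [Finset.mul_sum]
        refine Finset.sum_congr rfl fun z _ => ?_
        rw [show s * L z = s * H + s * (L z - H) by ring, Real.exp_add]
        ring
    _ ≤ Real.exp (s * H) * Real.exp (s ^ 2 * V' / 2) :=
        mul_le_mul_of_nonneg_left (hsum.trans hexp) (Real.exp_nonneg _)
    _ = Real.exp (s * H + s ^ 2 * V' / 2) := (Real.exp_add _ _).symm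

lemma exists_infoMgf_le {P : 𝒳 × 𝒴 → ℝ} (h0 : ∀ z, 0 ≤ P z) (h1 : ∑ z, P z = 1)
    (c : Bool × Bool) {V' : ℝ} (hV' : infoVar P c < V') :
    ∃ s₀ > 0, ∀ s, 0 ≤ s → s ≤ s₀ →
      infoMgf P c s ≤ Real.exp (s * infoMean P c + s ^ 2 * V' / 2) :=
  exists_sum_mul_exp_le P (infoDensity P c) h0 h1 _ _ V' rfl rfl hV'

/-! ### The union bound for maximum a posteriori decoding -/

/-- The sequences that agree with `s` outside the free coordinates and are at least as likely. -/
def competitors {ι : Type*} [Fintype ι] (P : 𝒳 × 𝒴 → ℝ) (c : ι → Bool × Bool)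
    (s : ι → 𝒳 × 𝒴) : Set (ι → 𝒳 × 𝒴) :=
  {s' | (∀ i, s' i ∈ slice (c i) (s i)) ∧ ∏ i, P (s i) ≤ ∏ i, P (s' i)}

/-- Every competitor has at least the mass of `s`, and all of them lie in a product of slices, whose
total mass factorises. -/
lemma ncard_competitors_mul_le {ι : Type*} [Fintype ι] {P : 𝒳 × 𝒴 → ℝ} (h0 : ∀ z, 0 ≤ P z)
    (c : ι → Bool × Bool) (s : ι → 𝒳 × 𝒴) :
    (competitors P c s).ncard * ∏ i, P (s i) ≤ ∏ i, sliceMass P (c i) (s i) := by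
  classical
  rw [Set.ncard_eq_toFinset_card', ← nsmul_eq_mul, ← Finset.sum_const]
  simp only [sliceMass]
  rw [Finset.prod_univ_sum]
  calc ∑ _s' ∈ (competitors P c s).toFinset, ∏ i, P (s i)
      ≤ ∑ s' ∈ (competitors P c s).toFinset, ∏ i, P (s' i) :=
        Finset.sum_le_sum fun s' hs' => (Set.mem_toFinset.mp hs').2
    _ ≤ _ := by
        refine Finset.sum_le_sum_of_subset_of_nonneg (fun s' hs' => ?_)
          fun s' _ _ => Finset.prod_nonneg fun i _ => h0 _
        exact Fintype.mem_piFinset.mpr (Set.mem_toFinset.mp hs').1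

lemma min_one_le_exp_mul {u σ : ℝ} (h0 : 0 ≤ σ) (h1 : σ ≤ 1) :
    min 1 (Real.exp u) ≤ Real.exp (σ * u) := by
  rcases le_total 0 u with h | h
  · exact (min_le_left _ _).trans (Real.one_le_exp (mul_nonneg h0 h))
  · refine (min_le_right _ _).trans (Real.exp_le_exp.mpr ?_)
    nlinarith

/-- A Chernoff-type bound: after the minimum is replaced by an exponential with tilt σ, the
expectation factorises over the independent symbols. Sequences of probability zero, for which the
counting bound is void, have weight zero. -/
lemma sum_prod_mul_min_le {ι : Type*} [Fintype ι] [DecidableEq ι] {P : 𝒳 × 𝒴 → ℝ}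
    (h0 : ∀ z, 0 ≤ P z) (c : ι → Bool × Bool) (R : ℝ) {σ : ℝ} (hσ0 : 0 ≤ σ) (hσ1 : σ ≤ 1) :
    ∑ s : ι → 𝒳 × 𝒴, (∏ i, P (s i)) * min 1 (Real.exp (-R) * (competitors P c s).ncard)
      ≤ Real.exp (-(σ * R)) * ∏ i, infoMgf P (c i) σ := by
  simp only [infoMgf]
  rw [Finset.prod_univ_sum, Fintype.piFinset_univ, Finset.mul_sum]
  refine Finset.sum_le_sum fun s _ => ?_
  rw [Finset.prod_mul_distrib]
  by_cases hs : ∀ i, 0 < P (s i)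
  · have hpos : 0 < ∏ i, P (s i) := Finset.prod_pos fun i _ => hs i
    have hcard : ((competitors P c s).ncard : ℝ) ≤ Real.exp (∑ i, infoDensity P (c i) (s i)) := by
      rw [Real.exp_sum]
      have : ∀ i, Real.exp (infoDensity P (c i) (s i)) = sliceMass P (c i) (s i) / P (s i) :=
        fun i => Real.exp_log (div_pos ((hs i).trans_le (le_sliceMass h0 _ _)) (hs i))
      simp only [this]
      rw [Finset.prod_div_distrib, le_div_iff₀ hpos]
      exact ncard_competitors_mul_le h0 c s
    calc (∏ i, P (s i)) * min 1 (Real.exp (-R) * (competitors P c s).ncard)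
        ≤ (∏ i, P (s i)) * min 1 (Real.exp (-R + ∑ i, infoDensity P (c i) (s i))) := by
          rw [Real.exp_add]
          gcongr
      _ ≤ (∏ i, P (s i)) * Real.exp (σ * (-R + ∑ i, infoDensity P (c i) (s i))) := by
          gcongr
          exact min_one_le_exp_mul hσ0 hσ1
      _ = _ := by
          rw [← Real.exp_sum, ← Finset.mul_sum, mul_add, Real.exp_add]
          ring_nf
  · push Not at hs
    obtain ⟨i, hi⟩ := hs
    have : ∏ i, P (s i) = 0 := Finset.prod_eq_zero (Finset.mem_univ i) (le_antisymm hi (h0 _))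
    simp [this]

end InfoDensity

/-! ### Random binning -/

section Binning

/-- The law of a sequence of independent uniform bin indices. -/
noncomputable def binLaw (N : ℕ) [NeZero N] : Measure (ℕ → Fin N) :=
  Measure.infinitePi fun _ => (PMF.uniformOfFintype (Fin N)).toMeasure

instance (N : ℕ) [NeZero N] : IsProbabilityMeasure (binLaw N) := by
  unfold binLaw
  infer_instance

lemma binLaw_cylinder (N : ℕ) [NeZero N] {κ : Type*} [Fintype κ] {f : κ → ℕ}
    (hf : Function.Injective f) (c : κ → Fin N) :
    binLaw N {w | ∀ k, w (f k) = c k} = ((N : ENNReal)⁻¹) ^ Fintype.card κ := by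
  classical
  have hset : {w : ℕ → Fin N | ∀ k, w (f k) = c k}
      = ((Finset.univ.image f : Finset ℕ) : Set ℕ).pi
        fun i => {Function.extend f c (fun _ => 0) i} := by
    ext w
    simp [Set.mem_pi, hf.extend_apply]
  rw [hset, binLaw, Measure.infinitePi_pi _ fun i _ => measurableSet_singleton _,
    Finset.prod_image fun a _ b _ h => hf h]
  simp [PMF.uniformOfFintype_apply]

/-- Two disjoint families of bins coincide with probability at most `N⁻¹` per pair. -/
lemma binLaw_collision_le (N : ℕ) [NeZero N] {κ : Type*} [Fintype κ] {f g : κ → ℕ}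
    (hfg : Function.Injective (Sum.elim f g)) :
    (binLaw N).real {w | ∀ k, w (f k) = w (g k)} ≤ ((N : ℝ)⁻¹) ^ Fintype.card κ := by
  classical
  -- Split according to the common value `c` of the bins: there are N^|κ| values, each of
  -- probability N^(-2|κ|).
  have hsub : {w : ℕ → Fin N | ∀ k, w (f k) = w (g k)}
      ⊆ ⋃ c : κ → Fin N, {w | ∀ k, w (Sum.elim f g k) = Sum.elim c c k} := by
    intro w hw
    simp only [Set.mem_iUnion]
    refine ⟨fun k => w (f k), ?_⟩
    rintro (k | k)
    · rfl
    · exact (hw k).symm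
  have hN : (N : ENNReal) ≠ 0 := by exact_mod_cast NeZero.ne N
  have hle : binLaw N {w | ∀ k, w (f k) = w (g k)} ≤ ((N : ENNReal)⁻¹) ^ Fintype.card κ := by
    calc binLaw N {w | ∀ k, w (f k) = w (g k)}
        ≤ ∑ c : κ → Fin N, binLaw N {w | ∀ k, w (Sum.elim f g k) = Sum.elim c c k} :=
          (measure_mono hsub).trans (measure_iUnion_fintype_le _ _)
      _ = ((N : ENNReal)⁻¹) ^ Fintype.card κ := by
          simp only [binLaw_cylinder N hfg]
          rw [Finset.sum_const, Finset.card_univ, Fintype.card_fun, Fintype.card_fin,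
            Fintype.card_sum, pow_add, nsmul_eq_mul, ← mul_assoc, Nat.cast_pow, ← mul_pow,
            ENNReal.mul_inv_cancel hN (ENNReal.natCast_ne_top N), one_pow, one_mul]
  calc (binLaw N).real {w | ∀ k, w (f k) = w (g k)}
      ≤ (((N : ENNReal)⁻¹) ^ Fintype.card κ).toReal := by
        refine ENNReal.toReal_mono ?_ hle
        exact ENNReal.pow_ne_top (ENNReal.inv_ne_top.mpr hN)
    _ = ((N : ℝ)⁻¹) ^ Fintype.card κ := by simp

variable {A : Type*}

/-- The first `k + 1` blocks of a stream of `τ > k` blocks. -/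
def streamPrefix {τ : ℕ} (x : Fin τ → A) (k : Fin τ) : Fin (k + 1) → A :=
  fun i => x (Fin.castLE k.isLt i)

/-- An injective numbering of the finite streams of blocks. -/
noncomputable def streamIndex [Finite A] (k : ℕ) (x : Fin k → A) : ℕ :=
  haveI : Nonempty ((Σ k : ℕ, (Fin k → A)) ↪ ℕ) := nonempty_embedding_nat _
  Classical.arbitrary ((Σ k : ℕ, (Fin k → A)) ↪ ℕ) ⟨k, x⟩

lemma streamIndex_inj [Finite A] {k l : ℕ} {x : Fin k → A} {y : Fin l → A}
    (h : streamIndex k x = streamIndex l y) :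
    (⟨k, x⟩ : Σ k : ℕ, (Fin k → A)) = ⟨l, y⟩ :=
  (Function.Embedding.injective _) h

/-- The codewords for the blocks of the stream `x` when the bins are given by `w`. -/
noncomputable def codewords [Finite A] {N τ : ℕ} (w : ℕ → Fin N) (x : Fin τ → A) : Fin τ → Fin N :=
  fun k => w (streamIndex (k + 1) (streamPrefix x k))

/-- `j` is the number of initial blocks in which `x` and `x'` agree. -/
def AgreeUpTo {τ : ℕ} (x x' : Fin τ → A) (j : ℕ) : Prop :=
  j ≤ τ ∧ (∀ i : Fin τ, (i : ℕ) < j → x' i = x i) ∧ ∀ h : j < τ, x' ⟨j, h⟩ ≠ x ⟨j, h⟩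

lemma exists_agreeUpTo {τ : ℕ} (x x' : Fin τ → A) : ∃ j, AgreeUpTo x x' j := by
  classical
  -- At `j = τ` the condition is vacuous, so the search terminates, and equal streams get the
  -- position `τ`.
  have hex : ∃ j, ∀ h : j < τ, x' ⟨j, h⟩ ≠ x ⟨j, h⟩ := ⟨τ, fun h => absurd h (lt_irrefl _)⟩
  refine ⟨Nat.find hex, Nat.find_min' hex fun h => absurd h (lt_irrefl _), fun i hi => ?_,
    Nat.find_spec hex⟩
  have := Nat.find_min hex hi
  push Not at this
  exact this.2

/-- All prefixes that include block `j` differ between the two streams, and prefixes of different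
lengths have different indices. Hence 2(τ - j) distinct bins are involved, which must agree in
pairs. -/
lemma collision_le [Finite A] (N : ℕ) [NeZero N] {τ j : ℕ} {x x' : Fin τ → A}
    (h : AgreeUpTo x x' j) :
    (binLaw N).real {w | codewords w x' = codewords w x} ≤ ((N : ℝ)⁻¹) ^ (τ - j) := by
  obtain ⟨hj, -, hne⟩ := h
  let f : (Fin τ → A) → Fin (τ - j) → ℕ := fun y k =>
    streamIndex (j + k + 1) (streamPrefix y ⟨j + k, by omega⟩)
  have hinj : Function.Injective (Sum.elim (f x') (f x)) := by
    have hlen : ∀ y y' : Fin τ → A, ∀ k l : Fin (τ - j), f y k = f y' l → k = l := by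
      intro y y' k l hkl
      have := congrArg Sigma.fst (streamIndex_inj hkl)
      ext
      simp only at this
      omega
    have hdiff : ∀ k l, f x' k ≠ f x l := by
      intro k l hkl
      obtain rfl := hlen _ _ _ _ hkl
      have h1 := eq_of_heq (Sigma.mk.inj (streamIndex_inj hkl)).2
      have hjk : j < j + k + 1 := by omega
      have hjτ : j < τ := by
        have := k.isLt
        omega
      exact hne hjτ (congrFun h1 ⟨j, hjk⟩)
    rintro (k | k) (l | l) hkl
    · rw [hlen _ _ _ _ hkl]
    · exact absurd hkl (hdiff _ _)
    · exact absurd hkl.symm (hdiff _ _)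
    · rw [hlen _ _ _ _ hkl]
  have hle := binLaw_collision_le N hinj
  rw [Fintype.card_fin] at hle
  refine (measureReal_mono ?_).trans hle
  intro w hw k
  exact congrFun hw ⟨j + k, by omega⟩

lemma measurable_codewords [Finite A] {N τ : ℕ} :
    Measurable fun (w : ℕ → Fin N) (x : Fin τ → A) => codewords w x :=
  measurable_pi_lambda _ fun _ => measurable_pi_lambda _ fun _ => measurable_pi_apply _

end Binning

/-! ### The code -/

section RandomCode

variable {𝒳 𝒴 : Type*} [Fintype 𝒳] [Fintype 𝒴] {n N₁ N₂ τ : ℕ}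

/-- The likelihood of a stream of pairs of blocks. -/
def weight (P : 𝒳 × 𝒴 → ℝ) (s : Fin τ → Fin n → 𝒳 × 𝒴) : ℝ := ∏ i, ∏ l, P (s i l)

/-- The stream of first components. -/
def fstStream (s : Fin τ → Fin n → 𝒳 × 𝒴) : Fin τ → Fin n → 𝒳 := fun i l => (s i l).1

/-- The stream of second components. -/
def sndStream (s : Fin τ → Fin n → 𝒳 × 𝒴) : Fin τ → Fin n → 𝒴 := fun i l => (s i l).2

/-- The streams that are mapped to the codewords `m₁`, `m₂` by the codebooks `E₁`, `E₂`. -/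
def compatible (E₁ : (Fin τ → Fin n → 𝒳) → Fin τ → Fin N₁)
    (E₂ : (Fin τ → Fin n → 𝒴) → Fin τ → Fin N₂) (m₁ : Fin τ → Fin N₁) (m₂ : Fin τ → Fin N₂) :
    Set (Fin τ → Fin n → 𝒳 × 𝒴) :=
  {s | E₁ (fstStream s) = m₁ ∧ E₂ (sndStream s) = m₂}

/-- Membership of the maximiser stands under the quantifier so that an empty `S` is allowed. In the
error analysis `S` contains the true stream. -/
lemma exists_mapEstimate [Nonempty (𝒳 × 𝒴)] (P : 𝒳 × 𝒴 → ℝ)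
    (S : Set (Fin τ → Fin n → 𝒳 × 𝒴)) :
    ∃ s, ∀ s' ∈ S, s ∈ S ∧ weight P s' ≤ weight P s := by
  rcases S.eq_empty_or_nonempty with h | h
  · exact ⟨Classical.arbitrary _, by simp [h]⟩
  · obtain ⟨s, hs, hmax⟩ := S.toFinite.exists_maximalFor (weight P) S h
    refine ⟨s, fun s' hs' => ⟨hs, ?_⟩⟩
    rcases le_total (weight P s') (weight P s) with h | h
    · exact h
    · exact hmax hs' h

/-- The maximum a posteriori estimate of the streams. -/
noncomputable def mapEstimate [Nonempty (𝒳 × 𝒴)] (P : 𝒳 × 𝒴 → ℝ)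
    (S : Set (Fin τ → Fin n → 𝒳 × 𝒴)) : Fin τ → Fin n → 𝒳 × 𝒴 :=
  (exists_mapEstimate P S).choose

open scoped Classical in
/-- The block of a stream that has to be decoded at time `τ` with delay `T`, if there is one. -/
noncomputable def delayedBlock {B : Type*} [Nonempty B] (T : ℕ) (x : Fin τ → B) : B :=
  if h : ∃ i : Fin τ, (i : ℕ) + T = τ then x h.choose else Classical.arbitrary B

lemma delayedBlock_eq {B : Type*} [Nonempty B] {T : ℕ} (x : Fin τ → B) {i : Fin τ}
    (hi : (i : ℕ) + T = τ) : delayedBlock T x = x i := by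
  have h : ∃ i : Fin τ, (i : ℕ) + T = τ := ⟨i, hi⟩
  rw [delayedBlock, dif_pos h]
  congr 1
  ext
  have := h.choose_spec
  omega

/-- The random binning code with maximum a posteriori decoding. -/
noncomputable def binningCode [Nonempty 𝒳] [Nonempty 𝒴] (P : 𝒳 × 𝒴 → ℝ) (n N₁ N₂ T₁ T₂ : ℕ)
    [NeZero N₁] [NeZero N₂] : Code 𝒳 𝒴 n N₁ N₂ where
  Seed := (ℕ → Fin N₁) × (ℕ → Fin N₂)
  seedSpace := inferInstance
  seedLaw := (binLaw N₁).prod (binLaw N₂)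
  isProb := inferInstance
  encX k w x := w.1 (streamIndex k x)
  encY k w y := w.2 (streamIndex k y)
  dec τ w m₁ m₂ :=
    (fun s : Fin τ → Fin n → 𝒳 × 𝒴 =>
        (delayedBlock T₁ (fstStream s), delayedBlock T₂ (sndStream s)))
      (mapEstimate P (compatible (codewords w.1) (codewords w.2) m₁ m₂))
  measurable_encX k x c :=
    measurableSet_eq_fun ((measurable_pi_apply _).comp measurable_fst) measurable_const
  measurable_encY k x c :=
    measurableSet_eq_fun ((measurable_pi_apply _).comp measurable_snd) measurable_const
  measurable_dec τ m₁ m₂ z := by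
    classical
    -- At time `τ` the decoder depends on the seed only through the two codebooks for `τ` blocks,
    -- which take finitely many values.
    have hm : Measurable fun w : (ℕ → Fin N₁) × (ℕ → Fin N₂) =>
        ((fun x : Fin τ → Fin n → 𝒳 => codewords w.1 x),
          (fun y : Fin τ → Fin n → 𝒴 => codewords w.2 y)) :=
      (measurable_codewords.comp measurable_fst).prodMk (measurable_codewords.comp measurable_snd)
    exact hm (Set.Finite.measurableSet (Set.toFinite
      {E : ((Fin τ → Fin n → 𝒳) → Fin τ → Fin N₁) × ((Fin τ → Fin n → 𝒴) → Fin τ → Fin N₂) |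
        (fun s : Fin τ → Fin n → 𝒳 × 𝒴 =>
          (delayedBlock T₁ (fstStream s), delayedBlock T₂ (sndStream s)))
        (mapEstimate P (compatible E.1 E.2 m₁ m₂)) = z}))

/-- The coordinates of block `i` that may be wrong if the first error in the two streams
occurs in the blocks `j.1` and `j.2`. -/
def errorPattern (j : ℕ × ℕ) (i : ℕ) : Bool × Bool := (decide (j.1 ≤ i), decide (j.2 ≤ i))

/-- The seeds for which a stream that is at least as likely as `s`, and first differs from it in
the blocks `j.1` and `j.2`, has the same codewords. -/
def confusionSet (P : 𝒳 × 𝒴 → ℝ) (N₁ N₂ : ℕ) (s : Fin τ → Fin n → 𝒳 × 𝒴) (j : ℕ × ℕ) :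
    Set ((ℕ → Fin N₁) × (ℕ → Fin N₂)) :=
  {w | ∃ s', weight P s ≤ weight P s' ∧ AgreeUpTo (fstStream s) (fstStream s') j.1 ∧
    AgreeUpTo (sndStream s) (sndStream s') j.2 ∧
    codewords w.1 (fstStream s') = codewords w.1 (fstStream s) ∧
    codewords w.2 (sndStream s') = codewords w.2 (sndStream s)}

/-- The pairs of positions of the first errors that lead to a decoding error with delay `T`. -/
def errorPositions (τ T : ℕ) : Finset (ℕ × ℕ) :=
  (Finset.range (τ + 1) ×ˢ Finset.range (τ + 1)).filter fun j => j.1 + T ≤ τ ∨ j.2 + T ≤ τ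

/-- The true stream is compatible with its own codewords, so the estimate is at least as likely. If
it is wrong in the block `i` with `i + T₁ = τ`, its first error in that stream is at some `j ≤ i`,
so `j + T₁ ≤ τ`; likewise for the other stream. -/
lemma errorSet_binningCode_subset [Nonempty 𝒳] [Nonempty 𝒴] (P : 𝒳 × 𝒴 → ℝ) (n N₁ N₂ T₁ T₂ : ℕ)
    [NeZero N₁] [NeZero N₂] (τ : ℕ) (s : Fin τ → Fin n → 𝒳 × 𝒴) :
    (binningCode P n N₁ N₂ T₁ T₂).errorSet T₁ T₂ τ s
      ⊆ ⋃ j ∈ errorPositions τ (min T₁ T₂), confusionSet P N₁ N₂ s j := by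
  intro w hw
  set m₁ := codewords w.1 (fstStream s) with hm₁
  set m₂ := codewords w.2 (sndStream s) with hm₂
  set s' := mapEstimate P (compatible (codewords w.1) (codewords w.2) m₁ m₂) with hs'
  have hout : (binningCode P n N₁ N₂ T₁ T₂).output τ s w
      = (delayedBlock T₁ (fstStream s'), delayedBlock T₂ (sndStream s')) := rfl
  obtain ⟨⟨hc₁, hc₂⟩, hle⟩ := (exists_mapEstimate P
    (compatible (codewords w.1) (codewords w.2) m₁ m₂)).choose_spec s ⟨rfl, rfl⟩
  change weight P s ≤ weight P s' at hle
  obtain ⟨j₁, hj₁⟩ := exists_agreeUpTo (fstStream s) (fstStream s')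
  obtain ⟨j₂, hj₂⟩ := exists_agreeUpTo (sndStream s) (sndStream s')
  refine Set.mem_biUnion (x := (j₁, j₂)) ?_ ⟨s', hle, hj₁, hj₂, hc₁, hc₂⟩
  rw [Finset.mem_coe]
  simp only [errorPositions, Finset.mem_filter, Finset.mem_product, Finset.mem_range]
  refine ⟨⟨Nat.lt_succ_of_le hj₁.1, Nat.lt_succ_of_le hj₂.1⟩, ?_⟩
  rcases hw with ⟨i, hi, hne⟩ | ⟨i, hi, hne⟩
  · left
    rw [hout] at hne
    simp only [delayedBlock_eq _ hi] at hne
    by_contra hcon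
    exact hne (hj₁.2.1 i (by omega))
  · right
    rw [hout] at hne
    simp only [delayedBlock_eq _ hi] at hne
    by_contra hcon
    exact hne (hj₂.2.1 i (by omega))

/-- The likely streams that agree with `s` in the blocks before the positions `j.1` and `j.2`. -/
def streamCompetitors (P : 𝒳 × 𝒴 → ℝ) (j : ℕ × ℕ) (s : Fin τ → Fin n → 𝒳 × 𝒴) :
    Set (Fin τ → Fin n → 𝒳 × 𝒴) :=
  {s' | (∀ (i : Fin τ) (l : Fin n), s' i l ∈ slice (errorPattern j i) (s i l)) ∧ weight P s ≤ weight P s'}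

/-- A union bound over the competitors; the independence of the two codebooks multiplies the
collision probabilities. Dropping the requirement to differ at the positions `j` only enlarges the
set of competitors and gives it a product structure. The trivial bound 1 is kept because the later
tilting needs it. -/
lemma confusionSet_measureReal_le (P : 𝒳 × 𝒴 → ℝ) (N₁ N₂ : ℕ) [NeZero N₁] [NeZero N₂]
    (s : Fin τ → Fin n → 𝒳 × 𝒴) (j : ℕ × ℕ) :
    ((binLaw N₁).prod (binLaw N₂)).real (confusionSet P N₁ N₂ s j)
      ≤ min 1 (Real.exp (-((τ - j.1 : ℕ) * Real.log N₁ + (τ - j.2 : ℕ) * Real.log N₂))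
        * (streamCompetitors P j s).ncard) := by
  classical
  refine le_min measureReal_le_one ?_
  have hN₁ : 0 < (N₁ : ℝ) := by exact_mod_cast NeZero.pos N₁
  have hN₂ : 0 < (N₂ : ℝ) := by exact_mod_cast NeZero.pos N₂
  set S : Finset (Fin τ → Fin n → 𝒳 × 𝒴) := Finset.univ.filter fun s' =>
    weight P s ≤ weight P s' ∧ AgreeUpTo (fstStream s) (fstStream s') j.1 ∧
      AgreeUpTo (sndStream s) (sndStream s') j.2 with hS
  have hsub : confusionSet P N₁ N₂ s j ⊆ ⋃ s' ∈ S,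
      {w | codewords w (fstStream s') = codewords w (fstStream s)} ×ˢ
      {w | codewords w (sndStream s') = codewords w (sndStream s)} := by
    rintro w ⟨s', h1, h2, h3, h4, h5⟩
    simp only [Set.mem_iUnion]
    exact ⟨s', by simp [hS, h1, h2, h3], h4, h5⟩
  have hcard : (S.card : ℝ) ≤ (streamCompetitors P j s).ncard := by
    rw [← Set.ncard_coe_finset]
    refine Nat.cast_le.mpr (Set.ncard_le_ncard (fun s' hs' => ?_) (Set.toFinite _))
    obtain ⟨h1, h2, h3⟩ := (Finset.mem_filter.mp (Finset.mem_coe.mp hs')).2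
    refine ⟨fun i l => mem_slice.mpr ⟨fun h => ?_, fun h => ?_⟩, h1⟩
    · exact congrFun (h2.2.1 i (by simpa [errorPattern] using h)) l
    · exact congrFun (h3.2.1 i (by simpa [errorPattern] using h)) l
  have hexp : Real.exp (-((τ - j.1 : ℕ) * Real.log N₁ + (τ - j.2 : ℕ) * Real.log N₂))
      = ((N₁ : ℝ)⁻¹) ^ (τ - j.1) * ((N₂ : ℝ)⁻¹) ^ (τ - j.2) := by
    rw [neg_add, Real.exp_add, ← mul_neg, ← mul_neg, Real.exp_nat_mul, Real.exp_nat_mul,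
      Real.exp_neg, Real.exp_neg, Real.exp_log hN₁, Real.exp_log hN₂]
  calc ((binLaw N₁).prod (binLaw N₂)).real (confusionSet P N₁ N₂ s j)
      ≤ ∑ s' ∈ S, ((binLaw N₁).prod (binLaw N₂)).real
          ({w | codewords w (fstStream s') = codewords w (fstStream s)} ×ˢ
            {w | codewords w (sndStream s') = codewords w (sndStream s)}) :=
        (measureReal_mono hsub (measure_ne_top _ _)).trans (measureReal_biUnion_finset_le _ _)
    _ ≤ ∑ _s' ∈ S, ((N₁ : ℝ)⁻¹) ^ (τ - j.1) * ((N₂ : ℝ)⁻¹) ^ (τ - j.2) := by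
        refine Finset.sum_le_sum fun s' hs' => ?_
        obtain ⟨h1, h2, h3⟩ := (Finset.mem_filter.mp hs').2
        rw [measureReal_prod_prod]
        exact mul_le_mul (collision_le N₁ h2) (collision_le N₂ h3) measureReal_nonneg
          (by positivity)
    _ ≤ _ := by
        rw [Finset.sum_const, nsmul_eq_mul, mul_comm, hexp]
        gcongr

/-- The contribution of a pattern of errors to the error probability. -/
lemma sum_weight_mul_min_le {P : 𝒳 × 𝒴 → ℝ} (h0 : ∀ z, 0 ≤ P z) (j : ℕ × ℕ) (R : ℝ) {σ : ℝ}
    (hσ0 : 0 ≤ σ) (hσ1 : σ ≤ 1) :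
    ∑ s : Fin τ → Fin n → 𝒳 × 𝒴,
        weight P s * min 1 (Real.exp (-R) * (streamCompetitors P j s).ncard)
      ≤ Real.exp (-(σ * R)) * ∏ i : Fin τ, infoMgf P (errorPattern j i) σ ^ n := by
  have h := sum_prod_mul_min_le (ι := Fin τ × Fin n) h0 (fun i => errorPattern j i.1) R hσ0 hσ1
  rw [Fintype.prod_prod_type] at h
  simp only [Finset.prod_const, Finset.card_univ, Fintype.card_fin] at h
  refine le_trans (le_of_eq ?_) h
  rw [← Equiv.sum_comp (Equiv.curry (Fin τ) (Fin n) (𝒳 × 𝒴))]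
  refine Finset.sum_congr rfl fun s _ => ?_
  have hw : ∀ s : Fin τ × Fin n → 𝒳 × 𝒴,
      weight P (Equiv.curry (Fin τ) (Fin n) (𝒳 × 𝒴) s) = ∏ i, P (s i) := fun s => by
    rw [Fintype.prod_prod_type]
    rfl
  rw [hw]
  congr 4
  rw [← Set.ncard_image_of_injective _ (Equiv.curry (Fin τ) (Fin n) (𝒳 × 𝒴)).injective]
  congr 1
  ext s'
  obtain ⟨t, rfl⟩ := (Equiv.curry (Fin τ) (Fin n) (𝒳 × 𝒴)).surjective s'
  rw [Equiv.injective _ |>.mem_set_image]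
  simp only [streamCompetitors, competitors, Set.mem_ofPred_eq, hw, Prod.forall]
  rfl

lemma weight_nonneg {α β : Type*} {P : α × β → ℝ} (h0 : ∀ z, 0 ≤ P z)
    (s : Fin τ → Fin n → α × β) : 0 ≤ weight P s :=
  Finset.prod_nonneg fun _ _ => Finset.prod_nonneg fun _ _ => h0 _

lemma sum_weight {P : 𝒳 × 𝒴 → ℝ} (h1 : ∑ z, P z = 1) :
    ∑ s : Fin τ → Fin n → 𝒳 × 𝒴, weight P s = 1 := by
  classical
  simp only [weight]
  have hb : ∑ b : Fin n → 𝒳 × 𝒴, ∏ l, P (b l) = 1 := by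
    rw [← Fintype.piFinset_univ, ← Finset.prod_univ_sum]
    simp [h1]
  have h := Finset.prod_univ_sum (fun _ : Fin τ => Finset.univ)
    fun (_ : Fin τ) (b : Fin n → 𝒳 × 𝒴) => ∏ l, P (b l)
  rw [Fintype.piFinset_univ] at h
  rw [← h]
  simp [hb]

lemma errorProb_le_one (C : Code 𝒳 𝒴 n N₁ N₂) {P : 𝒳 × 𝒴 → ℝ} (h0 : ∀ z, 0 ≤ P z)
    (h1 : ∑ z, P z = 1) (T₁ T₂ τ : ℕ) : C.errorProb P T₁ T₂ τ ≤ 1 := by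
  rw [← sum_weight (τ := τ) (n := n) h1]
  let := C.seedSpace
  have := C.isProb
  exact Finset.sum_le_sum fun s _ => mul_le_of_le_one_right (weight_nonneg h0 s) measureReal_le_one

/-- The error probability of random binning. -/
lemma errorProb_binningCode_le [Nonempty 𝒳] [Nonempty 𝒴] {P : 𝒳 × 𝒴 → ℝ} (h0 : ∀ z, 0 ≤ P z)
    (n N₁ N₂ T₁ T₂ : ℕ) [NeZero N₁] [NeZero N₂] (τ : ℕ) (σ : ℕ × ℕ → ℝ)
    (hσ0 : ∀ j, 0 ≤ σ j) (hσ1 : ∀ j, σ j ≤ 1) :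
    (binningCode P n N₁ N₂ T₁ T₂).errorProb P T₁ T₂ τ
      ≤ ∑ j ∈ errorPositions τ (min T₁ T₂),
        Real.exp (-(σ j * ((τ - j.1 : ℕ) * Real.log N₁ + (τ - j.2 : ℕ) * Real.log N₂)))
          * ∏ i : Fin τ, infoMgf P (errorPattern j i) (σ j) ^ n := by
  calc (binningCode P n N₁ N₂ T₁ T₂).errorProb P T₁ T₂ τ
      ≤ ∑ s : Fin τ → Fin n → 𝒳 × 𝒴, weight P s * ∑ j ∈ errorPositions τ (min T₁ T₂),
          min 1 (Real.exp (-((τ - j.1 : ℕ) * Real.log N₁ + (τ - j.2 : ℕ) * Real.log N₂))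
            * (streamCompetitors P j s).ncard) := by
        refine Finset.sum_le_sum fun s _ => mul_le_mul_of_nonneg_left ?_ (weight_nonneg h0 s)
        calc _ ≤ ((binLaw N₁).prod (binLaw N₂)).real
              (⋃ j ∈ errorPositions τ (min T₁ T₂), confusionSet P N₁ N₂ s j) :=
              measureReal_mono (errorSet_binningCode_subset P n N₁ N₂ T₁ T₂ τ s)
                (measure_ne_top _ _)
          _ ≤ _ := (measureReal_biUnion_finset_le _ _).trans
              (Finset.sum_le_sum fun j _ => confusionSet_measureReal_le P N₁ N₂ s j)
    _ = ∑ j ∈ errorPositions τ (min T₁ T₂), ∑ s : Fin τ → Fin n → 𝒳 × 𝒴, weight P s *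
          min 1 (Real.exp (-((τ - j.1 : ℕ) * Real.log N₁ + (τ - j.2 : ℕ) * Real.log N₂))
            * (streamCompetitors P j s).ncard) := by
        simp only [Finset.mul_sum]
        exact Finset.sum_comm
    _ ≤ _ := Finset.sum_le_sum fun j _ => sum_weight_mul_min_le h0 j _ (hσ0 j) (hσ1 j)

end RandomCode

/-! ### From exponents to achievability -/

section Achievability

/-- Eventually n ξ_n² ≥ log n. The divergence makes the geometric ratio small and absorbs constant
factors in the error bound. -/
lemma tendsto_mul_sq {ξ : ℕ → ℝ} (hξpos : ∀ n, 0 < ξ n)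
    (hξlog : Tendsto (fun n : ℕ => Real.log n / (n * ξ n ^ 2)) atTop (𝓝 0)) :
    Tendsto (fun n : ℕ => n * ξ n ^ 2) atTop atTop := by
  refine tendsto_atTop_mono' atTop ?_ (Real.tendsto_log_atTop.comp tendsto_natCast_atTop_atTop)
  filter_upwards [hξlog.eventually (gt_mem_nhds one_pos), eventually_gt_atTop 0] with n hn hn0
  have : 0 < (n : ℝ) * ξ n ^ 2 := by
    have := hξpos n
    positivity
  rw [div_lt_one this] at hn
  exact hn.le

lemma tendsto_mul_self {ξ : ℕ → ℝ} (hξpos : ∀ n, 0 < ξ n) (hξ : Tendsto ξ atTop (𝓝 0))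
    (hξlog : Tendsto (fun n : ℕ => Real.log n / (n * ξ n ^ 2)) atTop (𝓝 0)) :
    Tendsto (fun n : ℕ => n * ξ n) atTop atTop := by
  refine tendsto_atTop_mono' atTop ?_ (tendsto_mul_sq hξpos hξlog)
  filter_upwards [hξ.eventually (gt_mem_nhds one_pos)] with n hn
  have := hξpos n
  gcongr
  nlinarith

/-- Codebook sizes with first-order rate `R` and second-order rate `θ`. -/
noncomputable def bookSize (ξ : ℕ → ℝ) (R θ : ℝ) (n : ℕ) : ℕ :=
  ⌈Real.exp (n * (R + ξ n * θ))⌉₊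

instance (ξ : ℕ → ℝ) (R θ : ℝ) (n : ℕ) : NeZero (bookSize ξ R θ n) :=
  ⟨(Nat.ceil_pos.mpr (Real.exp_pos _)).ne'⟩

lemma le_log_bookSize (ξ : ℕ → ℝ) (R θ : ℝ) (n : ℕ) :
    n * (R + ξ n * θ) ≤ Real.log (bookSize ξ R θ n) :=
  (Real.le_log_iff_exp_le (by exact_mod_cast NeZero.pos _)).mpr (Nat.le_ceil _)

/-- For u ≥ 0 rounding e^u up at most doubles it, and log 2 is negligible against n ξ_n. This is why
the rate has to be eventually nonnegative. -/
lemma limsup_bookSize_le {ξ : ℕ → ℝ} (hξpos : ∀ n, 0 < ξ n)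
    (hnξ : Tendsto (fun n : ℕ => n * ξ n) atTop atTop) {R θ : ℝ}
    (hR : ∀ᶠ n in atTop, 0 ≤ R + ξ n * θ) :
    limsup (fun n : ℕ =>
      (((Real.log (bookSize ξ R θ n) - n * R) / (n * ξ n) : ℝ) : EReal)) atTop ≤ (θ : EReal) := by
  have hlim : Tendsto (fun n : ℕ => ((θ + Real.log 2 / (n * ξ n) : ℝ) : EReal)) atTop
      (𝓝 (θ : EReal)) := by
    refine (continuous_coe_real_ereal.tendsto θ).comp ?_
    simpa using (tendsto_const_nhds (x := θ)).add (hnξ.const_div_atTop (Real.log 2))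
  rw [← hlim.limsup_eq]
  refine limsup_le_limsup ?_
  filter_upwards [hR, eventually_gt_atTop 0] with n hn hn0
  rw [EReal.coe_le_coe_iff]
  have hξn := hξpos n
  have hpos : 0 < (n : ℝ) * ξ n := by positivity
  rw [div_le_iff₀ hpos, add_mul, div_mul_cancel₀ _ hpos.ne']
  have h1 : 1 ≤ Real.exp (n * (R + ξ n * θ)) := Real.one_le_exp (by positivity)
  have h2 : (bookSize ξ R θ n : ℝ) ≤ 2 * Real.exp (n * (R + ξ n * θ)) := by
    have := (Nat.ceil_lt_add_one (Real.exp_pos (n * (R + ξ n * θ))).le).le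
    unfold bookSize
    linarith
  have h3 := Real.log_le_log (by exact_mod_cast NeZero.pos _) h2
  rw [Real.log_mul two_ne_zero (Real.exp_ne_zero _), Real.log_exp] at h3
  linarith

/-- Induction on `τ`: a new block raises at most one of the three truncated differences, by one. The
minima with `τ` keep the formula valid for positions beyond `τ`. -/
lemma sum_errorPattern (f : Bool × Bool → ℝ) (hf : f (false, false) = 0) (j : ℕ × ℕ) (τ : ℕ) :
    ∑ i : Fin τ, f (errorPattern j i)
      = (min j.2 τ - j.1 : ℕ) * f (true, false) + (min j.1 τ - j.2 : ℕ) * f (false, true)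
        + (τ - max j.1 j.2 : ℕ) * f (true, true) := by
  rw [Fin.sum_univ_eq_sum_range fun i => f (errorPattern j i)]
  induction τ with
  | zero => simp
  | succ τ ih =>
    rw [Finset.sum_range_succ, ih]
    have key : ∀ p q r p' q' r' : ℕ, ∀ u v w : ℕ, p' = p + u → q' = q + v → r' = r + w →
        ∀ y : ℝ, y = u * f (true, false) + v * f (false, true) + w * f (true, true) →
        (p : ℝ) * f (true, false) + q * f (false, true) + r * f (true, true) + y
          = p' * f (true, false) + q' * f (false, true) + r' * f (true, true) := by
      intro p q r p' q' r' u v w h1 h2 h3 y h4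
      rw [h1, h2, h3, h4]
      push_cast
      ring
    by_cases h1 : j.1 ≤ τ <;> by_cases h2 : j.2 ≤ τ
    · refine key _ _ _ _ _ _ 0 0 1 (by omega) (by omega) (by omega) _ ?_
      simp [errorPattern, h1, h2]
    · refine key _ _ _ _ _ _ 1 0 0 (by omega) (by omega) (by omega) _ ?_
      simp [errorPattern, h1, h2]
    · refine key _ _ _ _ _ _ 0 1 0 (by omega) (by omega) (by omega) _ ?_
      simp [errorPattern, h1, h2]
    · refine key _ _ _ _ _ _ 0 0 0 (by omega) (by omega) (by omega) _ ?_
      simp [errorPattern, h1, h2, hf]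

variable {𝒳 𝒴 : Type*} [Fintype 𝒳] [Fintype 𝒴]

/-- The contribution of an error pattern, bounded through the three kinds of erroneous blocks. -/
lemma pattern_term_le {P : 𝒳 × 𝒴 → ℝ} (h0 : ∀ z, 0 ≤ P z) (h1 : ∑ z, P z = 1) {n τ : ℕ}
    {j : ℕ × ℕ} (hj₁ : j.1 ≤ τ) (hj₂ : j.2 ≤ τ) {σ L₁ L₂ r₁ r₂ : ℝ} (hσ : 0 ≤ σ)
    (hL₁ : n * r₁ ≤ L₁) (hL₂ : n * r₂ ≤ L₂) (m : Bool × Bool → ℝ) (hm0 : m (false, false) = 0)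
    (hm : ∀ c ≠ (false, false), infoMgf P c σ ≤ Real.exp (m c)) :
    Real.exp (-(σ * ((τ - j.1 : ℕ) * L₁ + (τ - j.2 : ℕ) * L₂)))
        * ∏ i : Fin τ, infoMgf P (errorPattern j i) σ ^ n
      ≤ Real.exp (n * ((j.2 - j.1 : ℕ) * (m (true, false) - σ * r₁)
          + (j.1 - j.2 : ℕ) * (m (false, true) - σ * r₂)
          + (τ - max j.1 j.2 : ℕ) * (m (true, true) - σ * (r₁ + r₂)))) := by
  have hprod : ∏ i : Fin τ, infoMgf P (errorPattern j i) σ ^ n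
      ≤ Real.exp (n * ∑ i : Fin τ, m (errorPattern j i)) := by
    rw [Finset.mul_sum, Real.exp_sum]
    refine Finset.prod_le_prod (fun i _ => pow_nonneg (infoMgf_nonneg h0 _ _) _) fun i _ => ?_
    rw [Real.exp_nat_mul]
    refine pow_le_pow_left₀ (infoMgf_nonneg h0 _ _) ?_ n
    by_cases hc : errorPattern j i = (false, false)
    · rw [hc, infoMgf_fixed h1, hm0, Real.exp_zero]
    · exact hm _ hc
  rw [sum_errorPattern m hm0, min_eq_left hj₁, min_eq_left hj₂] at hprod
  refine (mul_le_mul_of_nonneg_left hprod (Real.exp_nonneg _)).trans ?_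
  rw [← Real.exp_add]
  refine Real.exp_le_exp.mpr ?_
  -- The codewords of a stream after its first error are shared out among the blocks in which it
  -- alone is wrong and those in which both are.
  have e1 : τ - j.1 = (j.2 - j.1) + (τ - max j.1 j.2) := by omega
  have e2 : τ - j.2 = (j.1 - j.2) + (τ - max j.1 j.2) := by omega
  have g1 : σ * ((τ - j.1 : ℕ) * (n * r₁)) ≤ σ * ((τ - j.1 : ℕ) * L₁) := by gcongr
  have g2 : σ * ((τ - j.2 : ℕ) * (n * r₂)) ≤ σ * ((τ - j.2 : ℕ) * L₂) := by gcongr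
  rw [mul_add]
  rw [e1] at g1 ⊢
  rw [e2] at g2 ⊢
  push_cast at g1 g2 ⊢
  nlinarith

/-- The error patterns with `a` blocks in which only `X` is wrong, `b` blocks in which only `Y` is
wrong and `c` blocks in which both are wrong all have a moderate deviations exponent of at least
`E` per block; here `x` is the deviation, `d` are the first-order rate deficits and `V` the
variance factors. -/
def ExponentBound (E : ℝ) (V d : Bool × Bool → ℝ) (θ₁ θ₂ : ℝ) : Prop :=
  ∀ s₀ > 0, ∀ᶠ x in 𝓝[>] (0 : ℝ), ∀ a b c : ℕ, a = 0 ∨ b = 0 → ∃ σ, 0 ≤ σ ∧ σ ≤ s₀ ∧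
    a * (σ * d (true, false) - σ * x * θ₁ + σ ^ 2 * V (true, false) / 2)
      + b * (σ * d (false, true) - σ * x * θ₂ + σ ^ 2 * V (false, true) / 2)
      + c * (σ * d (true, true) - σ * x * (θ₁ + θ₂) + σ ^ 2 * V (true, true) / 2)
    ≤ -((a + b + c) * x ^ 2 * E)

/-- The difference between the information rate and the code rate. -/
noncomputable def rateDeficit (P : 𝒳 × 𝒴 → ℝ) (RX RY : ℝ) (c : Bool × Bool) : ℝ :=
  infoMean P c - ((if c.1 then RX else 0) + (if c.2 then RY else 0))

/-- With m = max(τ - j.1, τ - j.2) ≥ T one has E m ≥ T (E - 2η) + η ((τ - j.1) + (τ - j.2)). Giving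
up 2η per block thus buys geometric decay in both positions; each geometric series is at most 2,
whatever `τ` is. -/
lemma sum_errorPositions_le {τ T : ℕ} {y E η : ℝ} (hy : 0 ≤ y) (hη : 0 ≤ η) (hηE : 2 * η ≤ E)
    (hq : Real.exp (-(y * η)) ≤ 1 / 2) :
    ∑ j ∈ errorPositions τ T, Real.exp (-(y * E * (max (τ - j.1) (τ - j.2) : ℕ)))
      ≤ 4 * Real.exp (-(y * (T * (E - 2 * η)))) := by
  set q := Real.exp (-(y * η)) with hqdef
  have hq0 : 0 ≤ q := Real.exp_nonneg _
  have hgeom : ∑ i ∈ Finset.range (τ + 1), q ^ (τ - i) ≤ 2 := by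
    have h := Finset.sum_range_reflect (fun i => q ^ i) (τ + 1)
    simp only [Nat.add_sub_cancel] at h
    rw [h]
    exact (Finset.sum_le_sum fun i _ => pow_le_pow_left₀ hq0 hq i).trans (sum_geometric_two_le _)
  have hterm : ∀ j ∈ errorPositions τ T,
      Real.exp (-(y * E * (max (τ - j.1) (τ - j.2) : ℕ)))
        ≤ Real.exp (-(y * (T * (E - 2 * η)))) * (q ^ (τ - j.1) * q ^ (τ - j.2)) := by
    intro j hj
    simp only [errorPositions, Finset.mem_filter, Finset.mem_product, Finset.mem_range] at hj
    rw [hqdef, ← Real.exp_nat_mul, ← Real.exp_nat_mul, ← Real.exp_add, ← Real.exp_add]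
    refine Real.exp_le_exp.mpr ?_
    have h1 : (T : ℝ) ≤ (max (τ - j.1) (τ - j.2) : ℕ) := by
      exact_mod_cast (by omega : T ≤ max (τ - j.1) (τ - j.2))
    have h2 : ((τ - j.1 : ℕ) : ℝ) + (τ - j.2 : ℕ) ≤ 2 * (max (τ - j.1) (τ - j.2) : ℕ) := by
      exact_mod_cast (by omega : (τ - j.1) + (τ - j.2) ≤ 2 * max (τ - j.1) (τ - j.2))
    have h3 := mul_le_mul_of_nonneg_right h1 (sub_nonneg.mpr hηE)
    have h4 := mul_le_mul_of_nonneg_right h2 hη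
    have h5 := mul_le_mul_of_nonneg_left (add_le_add h3 h4) hy
    linarith
  calc _ ≤ ∑ j ∈ errorPositions τ T,
        Real.exp (-(y * (T * (E - 2 * η)))) * (q ^ (τ - j.1) * q ^ (τ - j.2)) :=
        Finset.sum_le_sum hterm
    _ ≤ ∑ j ∈ Finset.range (τ + 1) ×ˢ Finset.range (τ + 1),
        Real.exp (-(y * (T * (E - 2 * η)))) * (q ^ (τ - j.1) * q ^ (τ - j.2)) :=
        Finset.sum_le_sum_of_subset_of_nonneg (Finset.filter_subset _ _) fun j _ _ => by positivity
    _ = Real.exp (-(y * (T * (E - 2 * η)))) *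
        ((∑ i ∈ Finset.range (τ + 1), q ^ (τ - i)) * ∑ i ∈ Finset.range (τ + 1), q ^ (τ - i)) := by
        rw [← Finset.mul_sum, Finset.sum_mul_sum, Finset.sum_product]
    _ ≤ Real.exp (-(y * (T * (E - 2 * η)))) * (2 * 2) := by
        gcongr
    _ = _ := by ring

lemma nonempty_of_sum_eq_one {ι : Type*} [Fintype ι] {p : ι → ℝ} (h1 : ∑ z, p z = 1) :
    Nonempty ι := by
  by_contra hcon
  rw [not_nonempty_iff] at hcon
  simp at h1

/-- An exponent that holds for all error patterns yields codes. -/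
lemma eventually_existsCode {P : 𝒳 × 𝒴 → ℝ} (h0 : ∀ z, 0 ≤ P z) (h1 : ∑ z, P z = 1)
    {ξ : ℕ → ℝ} (hξpos : ∀ n, 0 < ξ n) (hξ : Tendsto ξ atTop (𝓝 0))
    (hξlog : Tendsto (fun n : ℕ => Real.log n / (n * ξ n ^ 2)) atTop (𝓝 0))
    {T₁ T₂ : ℕ} (hT₁ : 1 ≤ T₁) (hT₂ : 1 ≤ T₂) {RX RY θ₁ θ₂ E ν : ℝ} (hE : 0 < E)
    {V : Bool × Bool → ℝ} (hV : ∀ c, infoVar P c < V c)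
    (hexp : ExponentBound E V (rateDeficit P RX RY) θ₁ θ₂) (hν : ν < (min T₁ T₂ : ℕ) * E) :
    ∀ᶠ n in atTop, ExistsCode P n (bookSize ξ RX θ₁ n) (bookSize ξ RY θ₂ n) T₁ T₂
      (Real.exp (-(n * ξ n ^ 2 * ν))) := by
  have : Nonempty 𝒳 := (nonempty_of_sum_eq_one h1).map Prod.fst
  have : Nonempty 𝒴 := (nonempty_of_sum_eq_one h1).map Prod.snd
  set T := min T₁ T₂ with hT
  have hT0 : (1 : ℝ) ≤ T := by exact_mod_cast le_min hT₁ hT₂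
  choose s hs0 hs using fun c => exists_infoMgf_le h0 h1 c (hV c)
  have hξ0 : Tendsto ξ atTop (𝓝[>] 0) :=
    tendsto_nhdsWithin_iff.mpr ⟨hξ, Eventually.of_forall hξpos⟩
  -- Below this threshold all three moment generating function bounds hold, and the tilt is at most
  -- 1.
  set s₀ := min 1 (min (s (true, false)) (min (s (false, true)) (s (true, true)))) with hs₀
  have hs₀pos : 0 < s₀ := by simp [hs₀, hs0]
  have hs₀le : ∀ c ≠ (false, false), s₀ ≤ s c := by
    rintro ⟨_ | _, _ | _⟩ hc <;> simp [hs₀] at hc ⊢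
  obtain ⟨η, hη0, hηE, hηT⟩ : ∃ η > 0, 2 * η ≤ E ∧ ν < T * (E - 2 * η) := by
    -- The second term makes the loss 2Tη at most half of the gap TE - ν.
    refine ⟨min (E / 2) ((T * E - ν) / (4 * T)), lt_min (by linarith)
      (div_pos (by linarith) (by linarith)), ?_, ?_⟩
    · linarith [min_le_left (E / 2) ((T * E - ν) / (4 * T))]
    · have h := min_le_right (E / 2) ((T * E - ν) / (4 * T))
      rw [le_div_iff₀ (by linarith)] at h
      nlinarith
  set ρ := T * (E - 2 * η) - ν with hρ
  have hρ0 : 0 < ρ := by linarith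
  have hy := tendsto_mul_sq hξpos hξlog
  filter_upwards [hξ0.eventually (hexp s₀ hs₀pos),
    hy.eventually_ge_atTop (Real.log 2 / η), hy.eventually_ge_atTop (Real.log 4 / ρ)]
    with n hn hn2 hn4
  rw [div_le_iff₀ hη0] at hn2
  rw [div_le_iff₀ hρ0] at hn4
  have hy0 : 0 ≤ (n : ℝ) * ξ n ^ 2 := by positivity
  refine ⟨binningCode P n _ _ T₁ T₂, fun τ => ?_⟩
  -- The tilt is chosen separately for each error pattern. In the truncated differences `j.2 - j.1`
  -- and `j.1 - j.2` one always vanishes, as `ExponentBound` requires.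
  choose! σ hσ0 hσs hσ using hn
  have hσj : ∀ j : ℕ × ℕ, 0 ≤ σ (j.2 - j.1) (j.1 - j.2) (τ - max j.1 j.2) ∧
      σ (j.2 - j.1) (j.1 - j.2) (τ - max j.1 j.2) ≤ s₀ := fun j =>
    ⟨hσ0 _ _ _ (by omega), hσs _ _ _ (by omega)⟩
  calc _ ≤ _ := errorProb_binningCode_le h0 n _ _ T₁ T₂ τ
        (fun j => σ (j.2 - j.1) (j.1 - j.2) (τ - max j.1 j.2)) (fun j => (hσj j).1)
        (fun j => (hσj j).2.trans (min_le_left _ _))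
    _ ≤ ∑ j ∈ errorPositions τ T,
          Real.exp (-(n * ξ n ^ 2 * E * (max (τ - j.1) (τ - j.2) : ℕ))) := by
        refine Finset.sum_le_sum fun j hj => ?_
        simp only [errorPositions, Finset.mem_filter, Finset.mem_product, Finset.mem_range] at hj
        set σj := σ (j.2 - j.1) (j.1 - j.2) (τ - max j.1 j.2) with hσj_def
        obtain ⟨hσj0, hσj1⟩ := hσj j
        refine (pattern_term_le h0 h1 (by omega) (by omega) hσj0 (le_log_bookSize ξ RX θ₁ n)
          (le_log_bookSize ξ RY θ₂ n)
          (fun c => if c = (false, false) then 0 else σj * infoMean P c + σj ^ 2 * V c / 2)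
          (by simp) fun c hc => ?_).trans (Real.exp_le_exp.mpr ?_)
        · simp only [hc, if_false]
          exact hs c σj hσj0 (hσj1.trans (hs₀le c hc))
        · have hb := hσ (j.2 - j.1) (j.1 - j.2) (τ - max j.1 j.2) (by omega)
          rw [← hσj_def] at hb
          have e : ((max (τ - j.1) (τ - j.2) : ℕ) : ℝ)
              = (j.2 - j.1 : ℕ) + (j.1 - j.2 : ℕ) + (τ - max j.1 j.2 : ℕ) := by
            exact_mod_cast (by omega : max (τ - j.1) (τ - j.2)
              = (j.2 - j.1) + (j.1 - j.2) + (τ - max j.1 j.2))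
          rw [e]
          have hb2 := mul_le_mul_of_nonneg_left hb (Nat.cast_nonneg (α := ℝ) n)
          simp only [rateDeficit, if_true, Bool.false_eq_true, if_false, Prod.mk.injEq,
            Bool.true_eq_false, false_and, and_false] at hb2 ⊢
          linarith
    _ ≤ 4 * Real.exp (-(n * ξ n ^ 2 * (T * (E - 2 * η)))) := by
        refine sum_errorPositions_le hy0 hη0.le hηE ?_
        rw [Real.exp_neg, one_div]
        refine inv_anti₀ two_pos ?_
        rw [← Real.log_le_iff_le_exp two_pos]
        exact hn2
    _ ≤ Real.exp (-(n * ξ n ^ 2 * ν)) := by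
        have h4 : (4 : ℝ) ≤ Real.exp (n * ξ n ^ 2 * ρ) := by
          rw [← Real.log_le_iff_le_exp (by norm_num)]
          exact hn4
        refine (mul_le_mul_of_nonneg_right h4 (Real.exp_nonneg _)).trans ?_
        rw [← Real.exp_add]
        refine Real.exp_le_exp.mpr (le_of_eq ?_)
        rw [hρ]
        ring

lemma achievable_of_exponentBound {P : 𝒳 × 𝒴 → ℝ} (h0 : ∀ z, 0 ≤ P z) (h1 : ∑ z, P z = 1)
    {ξ : ℕ → ℝ} (hξpos : ∀ n, 0 < ξ n) (hξ : Tendsto ξ atTop (𝓝 0))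
    (hξlog : Tendsto (fun n : ℕ => Real.log n / (n * ξ n ^ 2)) atTop (𝓝 0))
    {T₁ T₂ : ℕ} (hT₁ : 1 ≤ T₁) (hT₂ : 1 ≤ T₂) {RX RY θ₁ θ₂ E ν : ℝ} (hE : 0 < E)
    (hRX : ∀ᶠ n in atTop, 0 ≤ RX + ξ n * θ₁) (hRY : ∀ᶠ n in atTop, 0 ≤ RY + ξ n * θ₂)
    {V : Bool × Bool → ℝ} (hV : ∀ c, infoVar P c < V c)
    (hexp : ExponentBound E V (rateDeficit P RX RY) θ₁ θ₂) (hν : ν < (min T₁ T₂ : ℕ) * E) :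
    Achievable P ξ RX RY θ₁ θ₂ T₁ T₂ ν := by
  classical
  have : Nonempty 𝒳 := (nonempty_of_sum_eq_one h1).map Prod.fst
  have : Nonempty 𝒴 := (nonempty_of_sum_eq_one h1).map Prod.snd
  have hev := eventually_existsCode h0 h1 hξpos hξ hξlog hT₁ hT₂ hE hV hexp hν
  have hnξ := tendsto_mul_self hξpos hξ hξlog
  refine ⟨bookSize ξ RX θ₁, bookSize ξ RY θ₂,
    -- Codes are required for every `n`; before the asymptotic bound takes effect the error bound 1
    -- serves, which every code satisfies.
    fun n => if ExistsCode P n (bookSize ξ RX θ₁ n) (bookSize ξ RY θ₂ n) T₁ T₂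
      (Real.exp (-(n * ξ n ^ 2 * ν))) then Real.exp (-(n * ξ n ^ 2 * ν)) else 1,
    fun n => ?_, fun n => ?_, limsup_bookSize_le hξpos hnξ hRX, limsup_bookSize_le hξpos hnξ hRY,
    ?_⟩
  · dsimp only
    split_ifs <;> positivity
  · dsimp only
    split_ifs with h
    · exact h
    · exact ⟨binningCode P n _ _ T₁ T₂, fun τ => errorProb_le_one _ h0 h1 _ _ _⟩
  · refine le_liminf_of_le (by isBoundedDefault) ?_
    filter_upwards [hev, eventually_gt_atTop 0] with n hn hn0
    rw [if_pos hn, Real.log_exp, EReal.coe_le_coe_iff, neg_div, neg_neg, mul_comm,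
      mul_div_assoc, div_self, mul_one]
    have := hξpos n
    positivity

/-- The exponents scale inversely with the variances: inflating all variances by 1 + δ lowers `e` to
E = e / (1 + δ). Every real number below T e is reached by a small enough δ. -/
lemma le_nuStar_of_exponentBound {P : 𝒳 × 𝒴 → ℝ} (h0 : ∀ z, 0 ≤ P z) (h1 : ∑ z, P z = 1)
    {ξ : ℕ → ℝ} (hξpos : ∀ n, 0 < ξ n) (hξ : Tendsto ξ atTop (𝓝 0))
    (hξlog : Tendsto (fun n : ℕ => Real.log n / (n * ξ n ^ 2)) atTop (𝓝 0))
    {T₁ T₂ : ℕ} (hT₁ : 1 ≤ T₁) (hT₂ : 1 ≤ T₂) {RX RY θ₁ θ₂ e : ℝ} (he : 0 < e)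
    (hRX : ∀ᶠ n in atTop, 0 ≤ RX + ξ n * θ₁) (hRY : ∀ᶠ n in atTop, 0 ≤ RY + ξ n * θ₂)
    (hV0 : ∀ c ≠ (false, false), 0 < infoVar P c)
    (hexp : ∀ E δ, 0 < E → 0 < δ → E * (1 + δ) = e →
      ExponentBound E (fun c => (1 + δ) * infoVar P c) (rateDeficit P RX RY) θ₁ θ₂) :
    (((min T₁ T₂ : ℕ) * e : ℝ) : EReal) ≤ nuStar P ξ RX RY θ₁ θ₂ T₁ T₂ := by
  set T := min T₁ T₂ with hT
  have hT0 : (1 : ℝ) ≤ T := by exact_mod_cast le_min hT₁ hT₂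
  refine le_of_forall_lt_imp_le_of_dense fun a ha => ?_
  obtain ⟨ν, haν, hν⟩ := EReal.lt_iff_exists_real_btwn.mp ha
  rw [EReal.coe_lt_coe_iff] at hν
  refine haν.le.trans (le_sSup ⟨ν, ?_, rfl⟩)
  have hνe : ν / T < e := by
    rw [div_lt_iff₀ (by linarith)]
    linarith
  obtain ⟨E, hE1, hE2⟩ := exists_between (max_lt hνe he)
  have hE0 : 0 < E := (le_max_right _ _).trans_lt hE1
  have hδ : 0 < e / E - 1 := by
    rw [sub_pos, one_lt_div hE0]
    exact hE2
  have hb := hexp E (e / E - 1) hE0 hδ (by field_simp; ring)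
  -- The density of a correct block has variance zero, so scaling cannot make its variance factor
  -- strictly larger. `ExponentBound` never reads this entry, which may be replaced.
  have hb' : ExponentBound E
      (fun c => if c = (false, false) then infoVar P c + 1 else (1 + (e / E - 1)) * infoVar P c)
      (rateDeficit P RX RY) θ₁ θ₂ := by
    simpa [ExponentBound] using hb
  refine achievable_of_exponentBound h0 h1 hξpos hξ hξlog hT₁ hT₂ hE0 hRX hRY (fun c => ?_) hb' ?_
  · split_ifs with hc
    · linarith
    · nlinarith [hV0 c hc]
  · have h := (le_max_left _ _).trans_lt hE1
    rw [div_lt_iff₀ (by linarith)] at h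
    linarith

end Achievability

/-! ### The exponents of the error patterns -/

section Exponents

/-- A strict rate surplus gives a negative term of order x, which dominates everything of order x².
-/
lemma eventually_exponent_le_of_neg (t d θ V E : ℝ) (ht : 0 < t) (hd : d < 0) :
    ∀ᶠ x in 𝓝[>] (0 : ℝ),
      x * t * d - x * t * x * θ + (x * t) ^ 2 * V / 2 ≤ -(x ^ 2 * E) := by
  have hlim : Tendsto (fun x : ℝ => t * d + x * (-t * θ + t ^ 2 * V / 2 + E)) (𝓝[>] 0)
      (𝓝 (t * d + 0 * (-t * θ + t ^ 2 * V / 2 + E))) :=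
    tendsto_nhdsWithin_of_tendsto_nhds (Continuous.tendsto (by fun_prop) 0)
  have hneg : t * d + 0 * (-t * θ + t ^ 2 * V / 2 + E) < 0 := by nlinarith
  filter_upwards [hlim.eventually (gt_mem_nhds hneg), self_mem_nhdsWithin] with x hx hx0
  have hx0' : (0 : ℝ) < x := hx0
  nlinarith [mul_neg_of_pos_of_neg hx0' hx]

/-- At zero deficit, t = Θ / V minimises -tΘ + t²V/2. -/
lemma exponent_eq {x Θ V : ℝ} (hV : 0 < V) :
    x * (Θ / V) * 0 - x * (Θ / V) * x * Θ + (x * (Θ / V)) ^ 2 * V / 2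
      = -(x ^ 2 * (Θ ^ 2 / (2 * V))) := by
  field_simp
  ring

lemma eventually_mul_le (t : ℝ) {s₀ : ℝ} (hs₀ : 0 < s₀) :
    ∀ᶠ x in 𝓝[>] (0 : ℝ), x * t ≤ s₀ := by
  have hlim : Tendsto (fun x : ℝ => x * t) (𝓝[>] 0) (𝓝 (0 * t)) :=
    tendsto_nhdsWithin_of_tendsto_nhds (Continuous.tendsto (by fun_prop) 0)
  rw [zero_mul] at hlim
  filter_upwards [hlim.eventually (gt_mem_nhds hs₀)] with x hx using hx.le

/-- A common deviation parameter `t` for all error patterns. -/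
lemma exponentBound_of_common {E θ₁ θ₂ t : ℝ} {V d : Bool × Bool → ℝ} (ht : 0 < t)
    (h₁ : ∀ᶠ x in 𝓝[>] (0 : ℝ), x * t * d (true, false) - x * t * x * θ₁
      + (x * t) ^ 2 * V (true, false) / 2 ≤ -(x ^ 2 * E))
    (h₂ : ∀ᶠ x in 𝓝[>] (0 : ℝ), x * t * d (false, true) - x * t * x * θ₂
      + (x * t) ^ 2 * V (false, true) / 2 ≤ -(x ^ 2 * E))
    (h₃ : ∀ᶠ x in 𝓝[>] (0 : ℝ), x * t * d (true, true) - x * t * x * (θ₁ + θ₂)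
      + (x * t) ^ 2 * V (true, true) / 2 ≤ -(x ^ 2 * E)) :
    ExponentBound E V d θ₁ θ₂ := by
  intro s₀ hs₀
  filter_upwards [h₁, h₂, h₃, eventually_mul_le t hs₀, self_mem_nhdsWithin]
    with x hx₁ hx₂ hx₃ hxs hx0 a b c _
  have hx0' : (0 : ℝ) < x := hx0
  refine ⟨x * t, by positivity, hxs, ?_⟩
  have g₁ := mul_le_mul_of_nonneg_left hx₁ (Nat.cast_nonneg (α := ℝ) a)
  have g₂ := mul_le_mul_of_nonneg_left hx₂ (Nat.cast_nonneg (α := ℝ) b)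
  have g₃ := mul_le_mul_of_nonneg_left hx₃ (Nat.cast_nonneg (α := ℝ) c)
  linarith

/-- The corner point: the deviation parameter depends on the fraction of the blocks in which only
`X` is wrong. -/
lemma exponentBound_corner {E θ₁ θ₂ : ℝ} {V d : Bool × Bool → ℝ} (hθ₁ : 0 < θ₁)
    (hθ : 0 < θ₁ + θ₂) (hV₁ : 0 < V (true, false)) (hV₃ : 0 < V (true, true))
    (hd₁ : d (true, false) = 0) (hd₂ : d (false, true) < 0) (hd₃ : d (true, true) = 0)
    (hE : ∀ γ, 0 ≤ γ → γ ≤ 1 → 2 * E * (γ * V (true, false) + (1 - γ) * V (true, true))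
      ≤ (θ₁ + (1 - γ) * θ₂) ^ 2) :
    ExponentBound E V d θ₁ θ₂ := by
  have hE₃ : E ≤ (θ₁ + θ₂) ^ 2 / (2 * V (true, true)) := by
    have := hE 0 le_rfl zero_le_one
    rw [le_div_iff₀ (by positivity)]
    linarith
  intro s₀ hs₀
  have ht₃ : 0 < (θ₁ + θ₂) / V (true, true) := by positivity
  filter_upwards [eventually_exponent_le_of_neg _ _ θ₂ (V (false, true)) E ht₃ hd₂,
    -- The sum of the two extreme parameters dominates all their mediants, so one condition on `x`
    -- serves for all block counts.
    eventually_mul_le (θ₁ / V (true, false) + (θ₁ + θ₂) / V (true, true)) hs₀,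
    self_mem_nhdsWithin] with x hx₂ hxs hx0 a b c hab
  have hx0' : (0 : ℝ) < x := hx0
  have ht₁ : 0 < θ₁ / V (true, false) := by positivity
  rcases hab with rfl | rfl
  -- No block has only X wrong: the parameter optimal for joint errors also works for the Y-only
  -- blocks, whose deficit is negative.
  · refine ⟨x * ((θ₁ + θ₂) / V (true, true)), by positivity, le_trans ?_ hxs, ?_⟩
    · gcongr
      linarith
    · have hx₃ := exponent_eq (x := x) (Θ := θ₁ + θ₂) hV₃
      have g₂ := mul_le_mul_of_nonneg_left hx₂ (Nat.cast_nonneg (α := ℝ) b)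
      have g₃ : x ^ 2 * E ≤ x ^ 2 * ((θ₁ + θ₂) ^ 2 / (2 * V (true, true))) := by gcongr
      have g₄ := mul_le_mul_of_nonneg_left g₃ (Nat.cast_nonneg (α := ℝ) c)
      rw [hd₃, hx₃]
      push_cast
      linarith
  · rcases Nat.eq_zero_or_pos (a + c) with h | h
    · obtain ⟨rfl, rfl⟩ : a = 0 ∧ c = 0 := by omega
      exact ⟨0, le_rfl, hs₀.le, by simp⟩
    have hac : (0 : ℝ) < a + c := by exact_mod_cast h
    -- Both remaining block types are critical. Total variance `W` and total rate margin `Θ` give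
    -- the optimal parameter Θ / W and the exponent Θ² / (2W), which `hE` at γ = a / (a + c)
    -- compares with (a + c) E.
    set W := a * V (true, false) + c * V (true, true) with hW
    set Θ := a * θ₁ + c * (θ₁ + θ₂) with hΘ
    have hW0 : 0 < W := by
      rcases Nat.eq_zero_or_pos a with ha | ha
      · have : 0 < c := by omega
        positivity
      · positivity
    have hΘ0 : 0 ≤ Θ := by positivity
    refine ⟨x * (Θ / W), by positivity, le_trans ?_ hxs, ?_⟩
    · gcongr
      rw [div_le_iff₀ hW0, add_mul]
      have k₁ : θ₁ / V (true, false) * W = a * θ₁ + θ₁ / V (true, false) * (c * V (true, true)) := by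
        rw [hW]
        field_simp
      have k₂ : (θ₁ + θ₂) / V (true, true) * W
          = (θ₁ + θ₂) / V (true, true) * (a * V (true, false)) + c * (θ₁ + θ₂) := by
        rw [hW]
        field_simp
      rw [k₁, k₂, hΘ]
      have k₃ : 0 ≤ θ₁ / V (true, false) * (c * V (true, true)) := by positivity
      have k₄ : 0 ≤ (θ₁ + θ₂) / V (true, true) * (a * V (true, false)) := by positivity
      linarith
    · have key : (a + c) * E ≤ Θ ^ 2 / (2 * W) := by
        have hγ := hE (a / (a + c)) (by positivity) (by
          rw [div_le_one hac]
          linarith [Nat.cast_nonneg (α := ℝ) c])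
        have e₁ : 1 - (a : ℝ) / (a + c) = c / (a + c) := by
          field_simp
          ring
        rw [e₁] at hγ
        have e₂ : 2 * E * (a / (a + c) * V (true, false) + c / (a + c) * V (true, true))
            = 2 * E * W / (a + c) := by
          rw [hW]
          field_simp
        have e₃ : θ₁ + c / (a + c) * θ₂ = Θ / (a + c) := by
          rw [hΘ]
          field_simp
          ring
        rw [e₂, e₃, div_pow, div_le_div_iff₀ hac (by positivity)] at hγ
        rw [le_div_iff₀ (by positivity)]
        have : (a + c) * (2 * E * W * (a + c)) ≤ (a + c) * Θ ^ 2 := by linarith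
        have := le_of_mul_le_mul_left this hac
        linarith
      have k := exponent_eq (x := x) (Θ := Θ) hW0
      have k₂ := mul_le_mul_of_nonneg_left key (sq_nonneg x)
      rw [hd₁, hd₃]
      push_cast
      have k₃ : a * (x * (Θ / W) * 0 - x * (Θ / W) * x * θ₁ + (x * (Θ / W)) ^ 2 * V (true, false) / 2)
          + c * (x * (Θ / W) * 0 - x * (Θ / W) * x * (θ₁ + θ₂)
            + (x * (Θ / W)) ^ 2 * V (true, true) / 2)
          = x * (Θ / W) * 0 - x * (Θ / W) * x * Θ + (x * (Θ / W)) ^ 2 * W / 2 := by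
        generalize Θ / W = t
        rw [hΘ, hW]
        ring
      linarith

end Exponents

end StreamingSW

/-! ### The three cases of the theorem -/

open StreamingSW in
theorem theorem3 {𝒳 𝒴 : Type*} [Fintype 𝒳] [Fintype 𝒴]
    (P : 𝒳 × 𝒴 → ℝ) (hP : P ∈ stdSimplex ℝ (𝒳 × 𝒴))
    (hV : 0 < StreamingSW.varentropy P)
    (hVX : 0 < StreamingSW.condVarentropy P)
    (hVY : 0 < StreamingSW.condVarentropy (StreamingSW.swapPmf P))
    (ξ : ℕ → ℝ) (hξpos : ∀ n, 0 < ξ n)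
    (hξ : Tendsto ξ atTop (𝓝 0))
    (hξlog : Tendsto (fun n : ℕ => Real.log n / (n * ξ n ^ 2)) atTop (𝓝 0))
    (T₁ T₂ : ℕ) (hT₁ : 1 ≤ T₁) (hT₂ : 1 ≤ T₂)
    (RX RY θ₁ θ₂ : ℝ) :
    -- Case (i)
    (RX = StreamingSW.condEntropy P →
      StreamingSW.entropy (StreamingSW.sndMarginal P) < RY →
      0 < θ₁ →
      (((min T₁ T₂ : ℕ) * θ₁ ^ 2 / (2 * StreamingSW.condVarentropy P) : ℝ) : EReal)
        ≤ StreamingSW.nuStar P ξ RX RY θ₁ θ₂ T₁ T₂) ∧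
    -- Case (ii)
    (RX = StreamingSW.condEntropy P →
      RY = StreamingSW.entropy (StreamingSW.sndMarginal P) →
      StreamingSW.condEntropy (StreamingSW.swapPmf P)
        < StreamingSW.entropy (StreamingSW.sndMarginal P) →
      0 < θ₁ → -θ₁ < θ₂ →
      (((min T₁ T₂ : ℕ) *
          min
            (⨅ γ : Set.Icc (0 : ℝ) 1,
              (θ₁ + (1 - (γ : ℝ)) * θ₂) ^ 2 /
                (2 * ((γ : ℝ) * StreamingSW.condVarentropy P
                  + (1 - (γ : ℝ)) * StreamingSW.varentropy P)))
            ((θ₁ + θ₂) ^ 2 / (2 * StreamingSW.varentropy P)) : ℝ) : EReal)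
        ≤ StreamingSW.nuStar P ξ RX RY θ₁ θ₂ T₁ T₂) ∧
    -- Case (iii)
    (RX + RY = StreamingSW.entropy P →
      StreamingSW.condEntropy P < RX →
      RX < StreamingSW.entropy (StreamingSW.fstMarginal P) →
      StreamingSW.condEntropy (StreamingSW.swapPmf P) < RY →
      RY < StreamingSW.entropy (StreamingSW.sndMarginal P) →
      -θ₁ < θ₂ →
      (((min T₁ T₂ : ℕ) * (θ₁ + θ₂) ^ 2 / (2 * StreamingSW.varentropy P) : ℝ) : EReal)
        ≤ StreamingSW.nuStar P ξ RX RY θ₁ θ₂ T₁ T₂) := by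
  obtain ⟨h0, h1⟩ := hP
  have hξ0 : ∀ R θ : ℝ, 0 < R → ∀ᶠ n in atTop, 0 ≤ R + ξ n * θ := fun R θ hR => by
    have hlim : Tendsto (fun n => R + ξ n * θ) atTop (𝓝 (R + 0 * θ)) :=
      tendsto_const_nhds.add (hξ.mul_const θ)
    rw [zero_mul, add_zero] at hlim
    filter_upwards [hlim.eventually (lt_mem_nhds hR)] with n hn using hn.le
  have hξ1 : ∀ R θ : ℝ, 0 ≤ R → 0 < θ → ∀ᶠ n in atTop, 0 ≤ R + ξ n * θ := fun R θ hR hθ =>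
    Eventually.of_forall fun n => add_nonneg hR (mul_nonneg (hξpos n).le hθ.le)
  have hVc : ∀ c ≠ (false, false), 0 < infoVar P c := by
    rintro ⟨_ | _, _ | _⟩ hc
    · exact absurd rfl hc
    · rwa [infoVar_snd]
    · rwa [infoVar_fst]
    · rwa [infoVar_both h1]
  have hX0 : 0 ≤ condEntropy P := infoMean_fst P ▸ infoMean_nonneg h0 _
  have hY0 : 0 ≤ condEntropy (swapPmf P) := infoMean_snd P ▸ infoMean_nonneg h0 _
  have hYle := condEntropy_swap_le h0 h1
  have hchain := entropy_eq_condEntropy_add h0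
  have hd₁ : rateDeficit P RX RY (true, false) = condEntropy P - RX := by
    simp [rateDeficit, infoMean_fst]
  have hd₂ : rateDeficit P RX RY (false, true) = condEntropy (swapPmf P) - RY := by
    simp [rateDeficit, infoMean_snd]
  have hd₃ : rateDeficit P RX RY (true, true) = entropy P - (RX + RY) := by
    simp [rateDeficit, infoMean_both h1]
  refine ⟨fun hRX hRY hθ₁ => ?_, fun hRX hRY hI hθ₁ hθ => ?_, fun hR hRX _ hRY _ hθ => ?_⟩
  · rw [mul_div_assoc]
    refine le_nuStar_of_exponentBound h0 h1 hξpos hξ hξlog hT₁ hT₂ (by positivity)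
      (hξ1 _ _ (by linarith) hθ₁) (hξ0 _ _ (by linarith)) hVc fun E δ hE hδ he => ?_
    have hV' : 0 < (1 + δ) * infoVar P (true, false) :=
      mul_pos (by linarith) (hVc _ (by simp))
    -- Only the X-only errors are critical: `RY` exceeds H(Y), so by the chain rule and since
    -- conditioning reduces entropy the other two deficits are negative.
    have ht : 0 < θ₁ / ((1 + δ) * infoVar P (true, false)) := by positivity
    refine exponentBound_of_common ht (Eventually.of_forall fun x => ?_)
      (eventually_exponent_le_of_neg _ _ _ _ _ ht (by linarith))
      (eventually_exponent_le_of_neg _ _ _ _ _ ht (by linarith))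
    rw [hd₁, hRX, sub_self, exponent_eq hV', infoVar_fst, eq_div_of_mul_eq (by positivity) he]
    refine le_of_eq ?_
    field_simp
  · have hθ' : 0 < θ₁ + θ₂ := by linarith
    set e := min
      (⨅ γ : Set.Icc (0 : ℝ) 1, (θ₁ + (1 - (γ : ℝ)) * θ₂) ^ 2 /
        (2 * ((γ : ℝ) * condVarentropy P + (1 - (γ : ℝ)) * varentropy P)))
      ((θ₁ + θ₂) ^ 2 / (2 * varentropy P)) with he_def
    have hden : ∀ γ : Set.Icc (0 : ℝ) 1,
        0 < (γ : ℝ) * condVarentropy P + (1 - (γ : ℝ)) * varentropy P := fun γ => by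
      obtain ⟨γ, hγ0, hγ1⟩ := γ
      rcases hγ0.eq_or_lt with h | h
      · simpa [← h] using hV
      · have : 0 ≤ (1 - γ) * varentropy P := mul_nonneg (by linarith) hV.le
        have := mul_pos h hVX
        dsimp only
        linarith
    have he0 : 0 < e := by
      refine lt_min ?_ (by positivity)
      -- The numerator's base is the convex combination γ θ₁ + (1 - γ)(θ₁ + θ₂), hence at least μ;
      -- this keeps the infimum positive.
      set μ := min θ₁ (θ₁ + θ₂) with hμ
      have hμ0 : 0 < μ := lt_min hθ₁ hθ'
      refine lt_of_lt_of_le (b := μ ^ 2 / (2 * (condVarentropy P + varentropy P)))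
        (by positivity) (le_ciInf fun γ => ?_)
      have h := hden γ
      obtain ⟨γ, hγ0, hγ1⟩ := γ
      dsimp only at h ⊢
      have hle : μ ≤ θ₁ + (1 - γ) * θ₂ := by
        have a₁ := mul_le_mul_of_nonneg_left (min_le_left θ₁ (θ₁ + θ₂)) hγ0
        have a₂ := mul_le_mul_of_nonneg_left (min_le_right θ₁ (θ₁ + θ₂)) (sub_nonneg.mpr hγ1)
        rw [← hμ] at a₁ a₂
        linarith
      gcongr
      · nlinarith
      · nlinarith
    refine le_nuStar_of_exponentBound h0 h1 hξpos hξ hξlog hT₁ hT₂ he0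
      (hξ1 _ _ (by linarith) hθ₁) (hξ0 _ _ (by linarith)) hVc fun E δ hE hδ he => ?_
    refine exponentBound_corner hθ₁ hθ' (mul_pos (by linarith) (hVc _ (by simp)))
      (mul_pos (by linarith) (hVc _ (by simp))) (by linarith) (by linarith) (by linarith)
      fun γ hγ0 hγ1 => ?_
    have hbdd : BddBelow (Set.range fun γ : Set.Icc (0 : ℝ) 1 => (θ₁ + (1 - (γ : ℝ)) * θ₂) ^ 2 /
        (2 * ((γ : ℝ) * condVarentropy P + (1 - (γ : ℝ)) * varentropy P))) := by
      refine ⟨0, ?_⟩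
      rintro _ ⟨γ, rfl⟩
      have := hden γ
      positivity
    -- The second term of the minimum is the value of the first at γ = 0, so the infimum alone
    -- carries all the information needed.
    have hle : e ≤ _ := (min_le_left _ _).trans (ciInf_le hbdd ⟨γ, hγ0, hγ1⟩)
    have hden' := hden ⟨γ, hγ0, hγ1⟩
    rw [← he, le_div_iff₀ (by linarith)] at hle
    rw [infoVar_fst, infoVar_both h1]
    linarith
  · have hθ' : 0 < θ₁ + θ₂ := by linarith
    rw [mul_div_assoc]
    refine le_nuStar_of_exponentBound h0 h1 hξpos hξ hξlog hT₁ hT₂ (by positivity)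
      (hξ0 _ _ (by linarith)) (hξ0 _ _ (by linarith)) hVc fun E δ hE hδ he => ?_
    have hV' : 0 < (1 + δ) * infoVar P (true, true) :=
      mul_pos (by linarith) (hVc _ (by simp))
    -- In the interior of the sum-rate face only joint errors are critical; both conditional
    -- deficits are negative.
    have ht : 0 < (θ₁ + θ₂) / ((1 + δ) * infoVar P (true, true)) := by positivity
    refine exponentBound_of_common ht
      (eventually_exponent_le_of_neg _ _ _ _ _ ht (by linarith))
      (eventually_exponent_le_of_neg _ _ _ _ _ ht (by linarith))
      (Eventually.of_forall fun x => ?_)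
    rw [hd₃, hR, sub_self, exponent_eq hV', infoVar_both h1, eq_div_of_mul_eq (by positivity) he]
    refine le_of_eq ?_
    field_simp
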